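/- **Setting.** For each $n\ge 1$ let $p_n$ be a dimension, $\Sigma_n$ a covariance matrix of size $p_n\times p_n$, and $X^{(1)},\dots,X^{(n)}$ i.i.d. random vectors in $\mathbb R^{p_n}$ with distribution $P_n=\mathcal N(0,\Sigma_n)$; let $X=(X_1,\dots,X_{p_n})$ denote a random vector with distribution $P_n$. For a directed acyclic graph (DAG) $G$ on $\{1,\dots,p_n\}$ let $\mathrm{pa}(i)$ be the set of parents of $i$ and $\mathrm{adj}(i,G)$ the set of vertices adjacent to $i$. Two DAGs are *equivalent* if they encode, through d-separation, the same conditional independence relations. Assume: * (A) $P_n$ is Markov (directed global Markov property) and faithful with respect to a DAG $G_n$: for all disjoint $A,B,S$, $X_A$ and $X_B$ are conditionally independent given $X_S$ if and only if $A$ and $B$ are d-separated by $S$ in $G_n$. * (B) $\operatorname{Var}(X_i)\le\sigma^2<\infty$ for all $n$ and all $i$, with $\sigma^2$ not depending on $n$. * (C) $p_n=O(n^a)$ for some $0\le a<\infty$. * (D) $q_n=\max_i|\mathrm{adj}(i,G_n)|$ satisfies $q_n=O(n^{1/2-b})$ for some $0<b\le 1/2$. * (F) There is $r>0$ such that for every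 $n$ and every DAG equivalent to $G_n$ (with its parent sets $\mathrm{pa}$), $\operatorname{Var}(X_j\mid X_{\mathrm{pa}(i)\setminus\{j\}})\ge r$ for all $i$ and $j\in\mathrm{pa}(i)$, and $\operatorname{Var}(X_i\mid X_{\mathrm{pa}(i)})\ge r$ for all $i$. **Estimator.** Let $\hat\Sigma=n^{-1}\sum_{k=1}^n (X^{(k)}-\overline X)(X^{(k)}-\overline X)^T$ be the sample covariance matrix. For a DAG $G$ let $\hat A$ be the matrix with $\hat A_{ii}=1$, $\hat A_{ij}=-\bigl(\hat\Sigma_{i,\mathrm{pa}(i)}(\hat\Sigma_{\mathrm{pa}(i),\mathrm{pa}(i)})^{-1}\bigr)_j$ for $j\in \mathrm{pa}(i)$, and $\hat A_{ij}=0$ otherwise; let $\widehat{\mathrm{Cov}}(\varepsilon)$ be the diagonal matrix with entries $\hat\Sigma_{i|\mathrm{pa}(i)}=\hat\Sigma_{i,i}-\hat\Sigma_{i,\mathrm{pa}(i)}(\hat\Sigma_{\mathrm{pa}(i),\mathrm{pa}(i)})^{-1}\hat\Sigma_{\mathrm{pa}(i),i}$; and put $$\hat\Sigma_{G,n}^{-1}=\hat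 A^T\,\widehat{\mathrm{Cov}}(\varepsilon)^{-1}\hat A$$ (where an inverse does not exist, the estimator may take an arbitrary conventional value). **Claim.** Each $\Sigma_n$ is invertible, and for every (deterministic) choice, for each $n$, of a DAG $G=G^{(n)}$ equivalent to $G_n$, $$\max_{1\le i,j\le p_n}\bigl|(\hat\Sigma^{-1}_{G,n})_{ij}-(\Sigma_n^{-1})_{ij}\bigr|\xrightarrow{\;P\;}0\qquad(n\to\infty).$$ -/

import Mathlib

open MeasureTheory ProbabilityTheory Filter Asymptotics
open scoped Matrix Topology

namespace DagCov

section Graphs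

variable {V : Type*}

/-- A directed graph is a DAG if it has no directed cycle (in particular no loop). -/
def IsDAG (G : Digraph V) : Prop := ∀ v, ¬ Relation.TransGen G.Adj v v

/-- The skeleton: the undirected graph obtained by removing all arrowheads. -/
def skeleton (G : Digraph V) : SimpleGraph V := G.toSimpleGraphInclusive

/-- `v` is a collider between the consecutive vertices `u`, `v`, `w` of a path: `u → v ← w`. -/
def IsCollider (G : Digraph V) (u v w : V) : Prop := G.Adj u v ∧ G.Adj w v

/-- `w` is a descendant of `v`: there is a directed path from `v` to `w`. -/
def IsDescendant (G : Digraph V) (v w : V) : Prop := Relation.TransGen G.Adj v w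

/-- The vertex in the middle of the consecutive vertices `u`, `v`, `w` of a path blocks the path
given `S`: either it is a non-collider in `S`, or it is a collider which is not in `S` and has no
descendant in `S`. -/
def BlocksAt (G : Digraph V) (S : Finset V) (u v w : V) : Prop :=
  (¬ IsCollider G u v w ∧ v ∈ S) ∨
  (IsCollider G u v w ∧ v ∉ S ∧ ∀ s ∈ S, ¬ IsDescendant G v s)

/-- A path is blocked by `S` if some interior vertex of it blocks it. (Endpoints are never
colliders, and for disjoint `A`, `B`, `S` an endpoint in `A` or `B` is never in `S`.) -/
def Blocked (G : Digraph V) (S : Finset V) {a b : V} (w : (skeleton G).Walk a b) : Prop :=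
  ∃ k, k + 2 ≤ w.length ∧ BlocksAt G S (w.getVert k) (w.getVert (k + 1)) (w.getVert (k + 2))

/-- `A` and `B` are d-separated by `S`: all paths from `A` to `B` are blocked by `S`. -/
def DSep (G : Digraph V) (A B S : Finset V) : Prop :=
  ∀ a ∈ A, ∀ b ∈ B, ∀ w : (skeleton G).Walk a b, w.IsPath → Blocked G S w

/-- Two directed graphs are equivalent if they encode, through d-separation, the same conditional
independence relations. -/
def Equivalent (G H : Digraph V) : Prop :=
  ∀ A B S : Finset V, Disjoint A B → Disjoint A S → Disjoint B S →
    (DSep G A B S ↔ DSep H A B S)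

variable [Fintype V]

open Classical in
/-- The set of parents of `i`. -/
noncomputable def pa (G : Digraph V) (i : V) : Finset V :=
  Finset.univ.filter fun j => G.Adj j i

open Classical in
/-- The adjacency set of `i`. -/
noncomputable def adjSet (G : Digraph V) (i : V) : Finset V :=
  Finset.univ.filter fun j => (skeleton G).Adj i j

/-- The maximal cardinality of the adjacency sets. -/
noncomputable def maxAdj (G : Digraph V) : ℕ :=
  Finset.univ.sup fun i => (adjSet G i).card

end Graphs

section Population

variable {p : ℕ}

/-- The subvector `x_K` of a vector `x`. -/
def coords (K : Finset (Fin p)) (x : EuclideanSpace ℝ (Fin p)) : K → ℝ := fun j => x j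

theorem measurable_coords (K : Finset (Fin p)) : Measurable (coords K) := by
  unfold coords
  fun_prop

/-- The σ-algebra generated by the subvector `X_K` of the canonical vector `X` on `ℝ^p`. -/
abbrev sigmaAlg (K : Finset (Fin p)) : MeasurableSpace (EuclideanSpace ℝ (Fin p)) :=
  MeasurableSpace.comap (coords K) inferInstance

theorem sigmaAlg_le (K : Finset (Fin p)) :
    sigmaAlg K ≤ (inferInstance : MeasurableSpace (EuclideanSpace ℝ (Fin p))) :=
  (measurable_coords K).comap_le

/-- `X_A` and `X_B` are conditionally independent given `X_S` when `X` has distribution `P`. -/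
def CondIndepCoords (P : Measure (EuclideanSpace ℝ (Fin p))) [IsFiniteMeasure P]
    (A B S : Finset (Fin p)) : Prop :=
  CondIndepFun (sigmaAlg S) (sigmaAlg_le S) (coords A) (coords B) P

/-- The directed global Markov property of `P` relative to `G`. -/
def IsMarkov (P : Measure (EuclideanSpace ℝ (Fin p))) [IsFiniteMeasure P]
    (G : Digraph (Fin p)) : Prop :=
  ∀ A B S : Finset (Fin p), Disjoint A B → Disjoint A S → Disjoint B S →
    DSep G A B S → CondIndepCoords P A B S

/-- `P` is faithful to `G`: conditional independence is the same as d-separation. -/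
def IsFaithful (P : Measure (EuclideanSpace ℝ (Fin p))) [IsFiniteMeasure P]
    (G : Digraph (Fin p)) : Prop :=
  ∀ A B S : Finset (Fin p), Disjoint A B → Disjoint A S → Disjoint B S →
    (CondIndepCoords P A B S ↔ DSep G A B S)

/-- The conditional variance `Var(X_i | X_K)` under `P` (a random variable on `ℝ^p`) is at least
`r`, almost surely. -/
def CondVarGE (P : Measure (EuclideanSpace ℝ (Fin p))) (i : Fin p) (K : Finset (Fin p)) (r : ℝ) :
    Prop :=
  ∀ᵐ x ∂P, r ≤ condVar (sigmaAlg K) (fun y : EuclideanSpace ℝ (Fin p) => y i) P x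

/-- The lower bound `r` on the conditional variances for a DAG `G`: `Var(X_j | X_{pa(i) \ j}) ≥ r`
for all `i` and `j ∈ pa(i)`, and `Var(X_i | X_{pa(i)}) ≥ r` for all `i`. -/
def CondVarBound (P : Measure (EuclideanSpace ℝ (Fin p))) (G : Digraph (Fin p)) (r : ℝ) : Prop :=
  (∀ i, ∀ j ∈ pa G i, CondVarGE P j ((pa G i).erase j) r) ∧
  (∀ i, CondVarGE P i (pa G i) r)

end Population

section Estimator

variable {p : ℕ}

/-- The row vector `S_{i,K} (S_{K,K})⁻¹` of coefficients of the regression of variable `i` on the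
variables in `K`, when the covariance matrix is `S`. -/
noncomputable def regCoef (S : Matrix (Fin p) (Fin p) ℝ) (i : Fin p) (K : Finset (Fin p)) :
    K → ℝ :=
  (fun k : K => S i k) ᵥ* (S.submatrix (fun k : K => (k : Fin p)) (fun k : K => (k : Fin p)))⁻¹

/-- The residual variance `S_{i|K} = S_{i,i} - S_{i,K} (S_{K,K})⁻¹ S_{K,i}`. -/
noncomputable def residVar (S : Matrix (Fin p) (Fin p) ℝ) (i : Fin p) (K : Finset (Fin p)) : ℝ :=
  S i i - regCoef S i K ⬝ᵥ (fun k : K => S k i)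

open Classical in
/-- The matrix `A` of the parent regressions: `1` on the diagonal, minus the regression coefficient
at `(i, j)` for `j ∈ pa(i)`, and `0` elsewhere. -/
noncomputable def regMatrix (S : Matrix (Fin p) (Fin p) ℝ) (G : Digraph (Fin p)) :
    Matrix (Fin p) (Fin p) ℝ :=
  Matrix.of fun i j =>
    if h : j ∈ pa G i then - regCoef S i (pa G i) ⟨j, h⟩ else if j = i then 1 else 0

/-- The diagonal matrix `Cov(ε)` of the residual variances of the parent regressions. -/
noncomputable def residCov (S : Matrix (Fin p) (Fin p) ℝ) (G : Digraph (Fin p)) :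
    Matrix (Fin p) (Fin p) ℝ :=
  Matrix.diagonal fun i => residVar S i (pa G i)

/-- The matrix `Aᵀ Cov(ε)⁻¹ A` built from `S` along the graph `G`. -/
noncomputable def concentration (S : Matrix (Fin p) (Fin p) ℝ) (G : Digraph (Fin p)) :
    Matrix (Fin p) (Fin p) ℝ :=
  (regMatrix S G)ᵀ * (residCov S G)⁻¹ * regMatrix S G

/-- The sample mean. -/
noncomputable def sampleMean {n : ℕ} (x : Fin n → EuclideanSpace ℝ (Fin p)) :
    EuclideanSpace ℝ (Fin p) :=
  (n : ℝ)⁻¹ • ∑ k, x k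

/-- The sample covariance matrix `n⁻¹ ∑ (x_k - x̄) (x_k - x̄)ᵀ` (the MLE). -/
noncomputable def sampleCov {n : ℕ} (x : Fin n → EuclideanSpace ℝ (Fin p)) :
    Matrix (Fin p) (Fin p) ℝ :=
  Matrix.of fun i j =>
    (n : ℝ)⁻¹ * ∑ k, (x k i - sampleMean x i) * (x k j - sampleMean x j)

/-- The DAG-based plug-in estimator of the concentration matrix. -/
noncomputable def concentrationEst {n : ℕ} (G : Digraph (Fin p))
    (x : Fin n → EuclideanSpace ℝ (Fin p)) : Matrix (Fin p) (Fin p) ℝ :=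
  concentration (sampleCov x) G

end Estimator

end DagCov

namespace DagCov

/-! ### d-separation and equivalent DAGs -/

section GraphLemmas

variable {V : Type*} {G H : Digraph V}

/-! Regress each X_i on its parents in G and call the residual ε_i. The Markov property passes from
the true DAG to the equivalent G, and it makes ε_i uncorrelated with every non-descendant of i other
than i. Of two vertices, one is not a descendant of the other, so distinct residuals are
uncorrelated: A Σ Aᵀ = D is diagonal with entries at least r. Hence Σ is invertible and Σ⁻¹ = Aᵀ D⁻¹
A (`isUnit_and_concentration_eq_inv`). The estimator is the same expression evaluated at the sample
covariance.

Entry (j, k) is ∑_i A_ij A_ik / D_i, where only j and its children contribute. Equivalent DAGs have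
the same skeleton, so there are at most q + 1 terms. It therefore suffices to estimate all
coefficients and residual variances within O(t), uniformly, with q t → 0
(`abs_concentration_sub_le`).

The coefficient errors must not themselves cost a factor q. Given the regressors X_K, the error of
coefficient j is a linear combination of independent Gaussian residuals, with variance D_i
(Σ̂_KK⁻¹)_jj / n. The lower bounds on conditional variances make (Σ̂_KK⁻¹)_jj ≤ 2 / r as soon as the
sample form dominates half the population form on K. That domination follows from entrywise
concentration in a Σ-orthonormal basis once |K| t is small (`measureReal_resVec_sub_le`,
`measureReal_regression_error_le`).

The failure probability is at most a constant times (p + 1)³ exp(-c n t²). With t = n^(-1/2 + b/2)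
the exponent is c n^b, which beats any power of n, while q t = O(n^(-b/2)). -/

theorem skeleton_adj {u v : V} : (skeleton G).Adj u v ↔ u ≠ v ∧ (G.Adj u v ∨ G.Adj v u) :=
  SimpleGraph.fromRel_adj _ _ _

theorem IsDAG.not_adj_self (hG : IsDAG G) (v : V) : ¬ G.Adj v v :=
  fun h => hG v (.single h)

/-- In a DAG, adjacent vertices are not d-separated by any set. -/
theorem not_dSep_of_skeleton_adj {u v : V} (h : (skeleton G).Adj u v) (S : Finset V) :
    ¬ DSep G {u} {v} S := by
  intro hsep
  obtain ⟨k, hk, -⟩ := hsep u (by simp) v (by simp) h.toWalk (by simpa using h.ne)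
  simp at hk

theorem IsDAG.not_isDescendant_or (hG : IsDAG G) (i j : V) :
    ¬ IsDescendant G i j ∨ ¬ IsDescendant G j i := by
  by_contra! h
  exact hG i (h.1.trans h.2)

variable [Fintype V]

theorem mem_pa {i j : V} : j ∈ pa G i ↔ G.Adj j i := by simp [pa]

theorem IsDAG.notMem_pa (hG : IsDAG G) (i : V) : i ∉ pa G i :=
  fun h => hG.not_adj_self i (mem_pa.1 h)

/-- The local Markov property of d-separation: the parents of a vertex separate it from each of
its other non-descendants. -/
theorem dSep_pa (hG : IsDAG G) {i m : V} (him : m ≠ i) (hm : m ∉ pa G i)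
    (hd : ¬ IsDescendant G i m) : DSep G {i} {m} (pa G i) := by
  intro a ha b hb w _
  obtain rfl := Finset.mem_singleton.1 ha
  obtain rfl := Finset.mem_singleton.1 hb
  have hlen : 0 < w.length := by
    refine Nat.pos_of_ne_zero fun h => him ?_
    exact (SimpleGraph.Walk.eq_of_length_eq_zero h).symm
  have h0 := w.adj_getVert_succ hlen
  rw [SimpleGraph.Walk.getVert_zero] at h0
  obtain ⟨-, h0 | h0⟩ := skeleton_adj.1 h0
  · by_contra hw
    -- On an unblocked path leaving `a` forwards, every edge points forwards. The first reversal
    -- would be a collider descending from `a`; neither it nor a descendant of it can be a parent of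
    -- `a` without closing a cycle, so it would block.
    have key : ∀ k, k + 1 ≤ w.length →
        G.Adj (w.getVert k) (w.getVert (k + 1)) ∧ IsDescendant G a (w.getVert (k + 1)) := by
      intro k
      induction k with
      | zero =>
        intro _
        rw [SimpleGraph.Walk.getVert_zero]
        exact ⟨h0, .single h0⟩
      | succ k ih =>
        intro hk
        obtain ⟨h1, h2⟩ := ih (by omega)
        obtain ⟨-, h3 | h3⟩ := skeleton_adj.1 (w.adj_getVert_succ (i := k + 1) (by omega))
        · exact ⟨h3, h2.tail h3⟩
        · refine absurd ⟨k, hk, Or.inr ⟨⟨h1, h3⟩, ?_, ?_⟩⟩ hw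
          · exact fun h => hG a (h2.tail (mem_pa.1 h))
          · exact fun s hs h => hG a ((h2.trans h).tail (mem_pa.1 hs))
    have := (key (w.length - 1) (by omega)).2
    rw [Nat.sub_add_cancel hlen, SimpleGraph.Walk.getVert_length] at this
    exact hd this
  -- If the path enters `a` through a parent, that parent is a non-collider in the separating set.
  -- It is an interior vertex because `b` is not a parent.
  · refine ⟨0, ?_, Or.inl ⟨?_, mem_pa.2 h0⟩⟩
    · by_contra hl
      have : w.length = 1 := by omega
      rw [zero_add, ← this, SimpleGraph.Walk.getVert_length] at h0
      exact hm (mem_pa.2 h0)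
    · rw [SimpleGraph.Walk.getVert_zero]
      exact fun h => hG a ((Relation.TransGen.single h.1).tail h0)

/-- Non-adjacent vertices of a DAG are separated by the parents of whichever one does not have the
other as a descendant, whereas no set separates vertices adjacent in G. This carries the sparsity of
the true DAG over to every equivalent DAG. -/
theorem IsDAG.skeleton_adj_of_equivalent (hH : IsDAG H) (hGH : Equivalent G H) {u v : V}
    (h : (skeleton G).Adj u v) : (skeleton H).Adj u v := by
  by_contra hn
  have huv := h.ne
  have aux : ∀ {u v : V}, u ≠ v → ¬ (skeleton H).Adj u v → (skeleton G).Adj u v →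
      ¬ IsDescendant H u v → False := by
    intro u v huv hn h hd
    have hv : v ∉ pa H u := fun h => hn (skeleton_adj.2 ⟨huv, Or.inr (mem_pa.1 h)⟩)
    refine not_dSep_of_skeleton_adj h _ ((hGH {u} {v} (pa H u) ?_ ?_ ?_).2
      (dSep_pa hH huv.symm hv hd))
    · simpa using huv
    · simpa using hH.notMem_pa u
    · simpa using hv
  rcases hH.not_isDescendant_or u v with hd | hd
  · exact aux huv hn h hd
  · exact aux huv.symm (fun h => hn h.symm) h.symm hd

theorem IsDAG.card_adjSet_le_of_equivalent (hH : IsDAG H) (hGH : Equivalent G H) (i : V) :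
    (adjSet G i).card ≤ maxAdj H := by
  refine le_trans (Finset.card_le_card fun j hj => ?_)
    (Finset.le_sup (f := fun i => (adjSet H i).card) (Finset.mem_univ i))
  simp only [adjSet, Finset.mem_filter, Finset.mem_univ, true_and] at hj ⊢
  exact hH.skeleton_adj_of_equivalent hGH hj

theorem IsDAG.pa_subset_adjSet (hG : IsDAG G) (i : V) : pa G i ⊆ adjSet G i := by
  intro j hj
  simp only [adjSet, Finset.mem_filter, Finset.mem_univ, true_and]
  refine skeleton_adj.2 ⟨?_, Or.inr (mem_pa.1 hj)⟩
  rintro rfl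
  exact hG.notMem_pa _ hj

theorem IsDAG.mem_adjSet_of_mem_pa (hG : IsDAG G) {i j : V} (hj : j ∈ pa G i) :
    i ∈ adjSet G j := by
  simp only [adjSet, Finset.mem_filter, Finset.mem_univ, true_and]
  refine skeleton_adj.2 ⟨?_, Or.inl (mem_pa.1 hj)⟩
  rintro rfl
  exact hG.notMem_pa _ hj

end GraphLemmas

end DagCov

namespace DagCov

/-! ### Linear functionals of a Gaussian vector -/

section Population

variable {p : ℕ}

/-- The linear functional `x ↦ ∑ i, u i * x i`. -/
def lin (u : Fin p → ℝ) (x : EuclideanSpace ℝ (Fin p)) : ℝ := ∑ i, u i * x i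

@[fun_prop]
theorem measurable_lin (u : Fin p → ℝ) : Measurable (lin u) := by
  unfold lin
  fun_prop

theorem lin_add_left (u v : Fin p → ℝ) (x : EuclideanSpace ℝ (Fin p)) :
    lin (u + v) x = lin u x + lin v x := by
  simp [lin, add_mul, Finset.sum_add_distrib]

theorem lin_sub_left (u v : Fin p → ℝ) (x : EuclideanSpace ℝ (Fin p)) :
    lin (u - v) x = lin u x - lin v x := by
  simp [lin, sub_mul, Finset.sum_sub_distrib]

theorem lin_single (i : Fin p) (x : EuclideanSpace ℝ (Fin p)) : lin (Pi.single i 1) x = x i := by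
  simp [lin, Pi.single_apply]

theorem lin_single' (i : Fin p) :
    lin (Pi.single i 1) = fun x : EuclideanSpace ℝ (Fin p) => x i := by
  ext x
  exact lin_single i x

/-- A linear functional with coefficients supported in `K` is measurable with respect to the
σ-algebra generated by the coordinates in `K`. -/
theorem measurable_lin_sigmaAlg {K : Finset (Fin p)} {w : Fin p → ℝ} (hw : ∀ j, j ∉ K → w j = 0) :
    Measurable[sigmaAlg K] (lin w) := by
  have h : lin w = (fun y : K → ℝ => ∑ j : K, w j * y j) ∘ coords K := by
    ext x
    simp only [lin, coords, Function.comp]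
    rw [Finset.sum_coe_sort K (fun j => w j * x j)]
    exact (Finset.sum_subset (Finset.subset_univ K) fun j _ hj => by simp [hw j hj]).symm
  rw [h]
  exact Measurable.comp (by fun_prop) (comap_measurable _)

variable {S : Matrix (Fin p) (Fin p) ℝ}

theorem hasGaussianLaw_eval :
    HasGaussianLaw (fun (x : EuclideanSpace ℝ (Fin p)) i => x i) (multivariateGaussian 0 S) :=
  IsGaussian.hasGaussianLaw_id.map_equiv (PiLp.continuousLinearEquiv 2 ℝ (fun _ : Fin p => ℝ))

theorem memLp_eval (i : Fin p) :
    MemLp (fun x : EuclideanSpace ℝ (Fin p) => x i) 2 (multivariateGaussian 0 S) :=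
  (hasGaussianLaw_eval.eval i).memLp_two

theorem memLp_lin (u : Fin p → ℝ) : MemLp (lin u) 2 (multivariateGaussian 0 S) :=
  memLp_finsetSum _ fun i _ => (memLp_eval i).const_mul (u i)

theorem integral_eval_multivariateGaussian (i : Fin p) :
    ∫ x, x i ∂(multivariateGaussian 0 S) = 0 := by
  have h := (EuclideanSpace.proj i : EuclideanSpace ℝ (Fin p) →L[ℝ] ℝ).integral_comp_comm
    (φ := fun x => x) (μ := multivariateGaussian 0 S) IsGaussian.integrable_fun_id
  simpa using h

theorem integral_lin (u : Fin p → ℝ) : ∫ x, lin u x ∂(multivariateGaussian 0 S) = 0 := by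
  unfold lin
  rw [integral_finsetSum _ fun i _ => ((memLp_eval i).integrable one_le_two).const_mul _]
  simp [integral_const_mul, integral_eval_multivariateGaussian]

theorem covariance_lin (hS : S.PosSemidef) (u v : Fin p → ℝ) :
    cov[lin u, lin v; multivariateGaussian 0 S] = u ⬝ᵥ S *ᵥ v := by
  have h := covariance_fun_sum_fun_sum (μ := multivariateGaussian 0 S)
    (X := fun i (x : EuclideanSpace ℝ (Fin p)) => u i * x i)
    (Y := fun i (x : EuclideanSpace ℝ (Fin p)) => v i * x i)
    (fun i => (memLp_eval i).const_mul _) (fun i => (memLp_eval i).const_mul _)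
  unfold lin
  rw [h]
  simp_rw [covariance_const_mul_left, covariance_const_mul_right,
    covariance_eval_multivariateGaussian hS, dotProduct, Matrix.mulVec, dotProduct, Finset.mul_sum]
  refine Finset.sum_congr rfl fun i _ => Finset.sum_congr rfl fun j _ => by ring

theorem integral_lin_mul_lin (hS : S.PosSemidef) (u v : Fin p → ℝ) :
    ∫ x, lin u x * lin v x ∂(multivariateGaussian 0 S) = u ⬝ᵥ S *ᵥ v := by
  rw [← covariance_lin hS, covariance_eq_sub (memLp_lin u) (memLp_lin v), integral_lin]
  simp

theorem hasLaw_lin (hS : S.PosSemidef) (u : Fin p → ℝ) :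
    HasLaw (lin u) (gaussianReal 0 (u ⬝ᵥ S *ᵥ u).toNNReal) (multivariateGaussian 0 S) where
  aemeasurable := (measurable_lin u).aemeasurable
  map_eq := by
    have h : HasGaussianLaw (lin u) (multivariateGaussian 0 S) := by
      refine (hasGaussianLaw_eval (S := S)).map_fun
        (∑ i, u i • ContinuousLinearMap.proj (R := ℝ) (φ := fun _ : Fin p => ℝ) i) |>.congr ?_
      filter_upwards with x
      simp [lin]
    rw [h.map_eq_gaussianReal, integral_lin, ← covariance_self (measurable_lin u).aemeasurable,
      covariance_lin hS]

/-- A lower bound on the conditional variance bounds the variance of every linear combination. -/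
theorem CondVarGE.le_dotProduct (hS : S.PosSemidef) {i : Fin p} {K : Finset (Fin p)} {r : ℝ}
    (h : CondVarGE (multivariateGaussian 0 S) i K r) {w : Fin p → ℝ}
    (hw : ∀ j, j ∉ K → w j = 0) :
    r ≤ (Pi.single i 1 + w) ⬝ᵥ S *ᵥ (Pi.single i 1 + w) := by
  set P := multivariateGaussian 0 S with hP
  set m := sigmaAlg K
  have hm : m ≤ _ := sigmaAlg_le K
  set X : EuclideanSpace ℝ (Fin p) → ℝ := fun x => x i
  have hX : MemLp X 2 P := memLp_eval i
  have hwm : MemLp (lin w) 2 P := memLp_lin w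
  have hcw : P[lin w | m] = lin w := condExp_of_stronglyMeasurable hm
    (measurable_lin_sigmaAlg hw).stronglyMeasurable (hwm.integrable one_le_two)
  have h1 : P[X + lin w | m] =ᵐ[P] P[X | m] + lin w := by
    have := condExp_add (m := m) (hX.integrable one_le_two) (hwm.integrable one_le_two)
    rwa [hcw] at this
  -- Adding a function of X_K leaves the conditional variance unchanged, and it is at most the
  -- conditional second moment, whose integral is the quadratic form.
  have h2 : Var[X + lin w; P | m] =ᵐ[P] Var[X; P | m] := by
    refine condExp_congr_ae ?_
    filter_upwards [h1] with x hx
    simp [hx]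
  have h3 := condVar_ae_le_condExp_sq hm (hX.add hwm)
  have h4 : ∀ᵐ x ∂P, r ≤ (P[(X + lin w) ^ 2 | m]) x := by
    filter_upwards [h, h2, h3] with x ha hb hc
    exact (ha.trans hb.ge).trans hc
  have h5 : r ≤ ∫ x, (P[(X + lin w) ^ 2 | m]) x ∂P := by
    have := integral_mono_ae (integrable_const r) integrable_condExp h4
    simpa using this
  rw [integral_condExp hm] at h5
  rw [← integral_lin_mul_lin hS]
  refine h5.trans_eq (integral_congr_ae (.of_forall fun x => ?_))
  simp [lin_add_left, lin_single, X, sq]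

/-- Homogeneous form of `CondVarGE.le_dotProduct`: divide by `w i`. If `w i = 0`, positive
semidefiniteness is enough. -/
theorem CondVarGE.sq_mul_le (hS : S.PosSemidef) {i : Fin p} {K : Finset (Fin p)} {r : ℝ}
    (h : CondVarGE (multivariateGaussian 0 S) i K r) {w : Fin p → ℝ}
    (hw : ∀ j, j ∉ K → j ≠ i → w j = 0) (hi : i ∉ K) :
    r * w i ^ 2 ≤ w ⬝ᵥ S *ᵥ w := by
  by_cases h0 : w i = 0
  · simpa [h0] using hS.dotProduct_mulVec_nonneg w
  · have := h.le_dotProduct hS (w := (w i)⁻¹ • w - Pi.single i 1) fun j hj => by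
      by_cases hji : j = i
      · subst hji
        simp [h0]
      · simp [hw j hj hji, hji]
    rw [add_sub_cancel, Matrix.mulVec_smul, dotProduct_smul, smul_dotProduct, smul_eq_mul,
      smul_eq_mul, ← mul_assoc, ← sq, inv_pow, ← div_eq_inv_mul,
      le_div_iff₀ (by positivity)] at this
    exact this

end Population

/-! ### From conditional independence to uncorrelated residuals -/

section CondIndep

variable {Ω : Type*} {m mΩ : MeasurableSpace Ω} [StandardBorelSpace Ω] {μ : Measure Ω}
  [IsFiniteMeasure μ]

/-- The conditional expectation of a product of conditionally independent random variables. -/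
theorem CondIndepFun.condExp_mul (hm : m ≤ mΩ) {X Y : Ω → ℝ} (h : CondIndepFun m hm X Y μ)
    (hX : Measurable X) (hY : Measurable Y) (hX2 : MemLp X 2 μ) (hY2 : MemLp Y 2 μ) :
    μ[X * Y | m] =ᵐ[μ] μ[X | m] * μ[Y | m] := by
  have h1 := ae_of_ae_trim hm ((condIndepFun_iff_map_prod_eq_prod_map_map hX hY).1 h)
  filter_upwards [h1, condExp_ae_eq_integral_condExpKernel hm (hX2.integrable one_le_two),
    condExp_ae_eq_integral_condExpKernel hm (hY2.integrable one_le_two),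
    condExp_ae_eq_integral_condExpKernel hm (hX2.integrable_mul hY2)] with ω h1 h2 h3 h4
  rw [Pi.mul_apply, h2, h3, h4]
  rw [Kernel.map_apply _ (by fun_prop), Kernel.prod_apply, Kernel.map_apply _ hX,
    Kernel.map_apply _ hY] at h1
  have := (indepFun_iff_map_prod_eq_prod_map_map hX.aemeasurable hY.aemeasurable).2 h1
  exact this.integral_mul_eq_mul_integral hX.aestronglyMeasurable hY.aestronglyMeasurable

end CondIndep

section Population

variable {p : ℕ} {S : Matrix (Fin p) (Fin p) ℝ}

/-- A residual which is uncorrelated with the coordinates in `K` is centred given `X_K`. -/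
theorem condExp_lin_eq_zero (hS : S.PosSemidef) {K : Finset (Fin p)} {a : Fin p → ℝ}
    (ha : ∀ k ∈ K, (S *ᵥ a) k = 0) :
    (multivariateGaussian 0 S)[lin a | sigmaAlg K] =ᵐ[multivariateGaussian 0 S] 0 := by
  -- Jointly Gaussian and uncorrelated implies independent. The index type `Unit` turns the single
  -- residual into a family, as the criterion for two Gaussian blocks requires.
  have hG : HasGaussianLaw (fun x : EuclideanSpace ℝ (Fin p) =>
      (fun _ : Unit => lin a x, fun k : K => x k)) (multivariateGaussian 0 S) := by
    refine (hasGaussianLaw_eval (S := S)).map_fun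
      ((ContinuousLinearMap.pi fun _ : Unit =>
        ∑ i, a i • ContinuousLinearMap.proj (R := ℝ) (φ := fun _ : Fin p => ℝ) i).prod
        (ContinuousLinearMap.pi fun k : K =>
          ContinuousLinearMap.proj (R := ℝ) (φ := fun _ : Fin p => ℝ) (k : Fin p))) |>.congr ?_
    filter_upwards with x
    ext <;> simp [lin]
  have hind : IndepFun (fun x (_ : Unit) => lin a x) (coords K) (multivariateGaussian 0 S) := by
    refine hG.indepFun_of_covariance_eval (X := fun _ => lin a) (Y := fun (k : K) x => x k) ?_
    intro _ k
    rw [← lin_single' (k : Fin p), covariance_comm, covariance_lin hS]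
    simpa using ha k k.2
  have hind' : IndepFun (lin a) (coords K) (multivariateGaussian 0 S) :=
    hind.comp (φ := fun f : Unit → ℝ => f ()) (ψ := id) (by fun_prop) measurable_id
  have h := condExp_indep_eq (μ := multivariateGaussian 0 S) (f := lin a)
    (measurable_lin a).comap_le (sigmaAlg_le K) (comap_measurable (lin a)).stronglyMeasurable hind'
  rw [integral_lin] at h
  exact h

/-- Here `a` is the residual X_i + w, with w a function of X_K, so E[X_i | X_K] = -w. Conditional
independence gives E[X_i X_m] = E[-w E[X_m | X_K]] = -E[w X_m], that is, the residual is
uncorrelated with X_m. -/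
theorem mulVec_eq_zero_of_condIndepCoords (hS : S.PosSemidef) {K : Finset (Fin p)} {i m : Fin p}
    {a : Fin p → ℝ} (hai : a i = 1) (haK : ∀ j, j ∉ K → j ≠ i → a j = 0)
    (ha : ∀ k ∈ K, (S *ᵥ a) k = 0)
    (h : CondIndepCoords (multivariateGaussian 0 S) {i} {m} K) : (S *ᵥ a) m = 0 := by
  set P := multivariateGaussian 0 S
  have hX (j : Fin p) : MemLp (fun x : EuclideanSpace ℝ (Fin p) => x j) 2 P := memLp_eval j
  have hXm (j : Fin p) : Measurable (fun x : EuclideanSpace ℝ (Fin p) => x j) := by fun_prop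
  have h1 : CondIndepFun (sigmaAlg K) (sigmaAlg_le K) (fun x => x i) (fun x => x m) P :=
    CondIndepFun.comp h (φ := fun f : ({i} : Finset (Fin p)) → ℝ => f ⟨i, by simp⟩)
      (ψ := fun f : ({m} : Finset (Fin p)) → ℝ => f ⟨m, by simp⟩) (by fun_prop) (by fun_prop)
  have h2 := CondIndepFun.condExp_mul _ h1 (hXm i) (hXm m) (hX i) (hX m)
  set w : Fin p → ℝ := a - Pi.single i 1 with hw
  have hlin : lin a = (fun x => x i) + lin w := by
    ext x
    simp [hw, lin_sub_left, lin_single]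
  have hwK : ∀ j, j ∉ K → w j = 0 := fun j hj => by
    by_cases hji : j = i
    · subst hji
      simp [hw, hai]
    · simp [hw, hji, haK j hj hji]
  have hwm : StronglyMeasurable[sigmaAlg K] (lin w) :=
    (measurable_lin_sigmaAlg hwK).stronglyMeasurable
  have hw2 : MemLp (lin w) 2 P := memLp_lin w
  have h3 : P[fun x => x i | sigmaAlg K] =ᵐ[P] -lin w := by
    have h4 := condExp_add (m := sigmaAlg K) ((hX i).integrable one_le_two)
      (hw2.integrable one_le_two)
    rw [condExp_of_stronglyMeasurable (sigmaAlg_le K) hwm (hw2.integrable one_le_two),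
      ← hlin] at h4
    filter_upwards [h4, condExp_lin_eq_zero hS ha] with x h5 h6
    rw [h6] at h5
    simp only [Pi.zero_apply, Pi.add_apply] at h5
    simp only [Pi.neg_apply]
    linarith
  have h4 := condExp_mul_of_stronglyMeasurable_left (μ := P)
    (g := fun x : EuclideanSpace ℝ (Fin p) => x m) hwm
    (hw2.integrable_mul (hX m)) ((hX m).integrable one_le_two)
  have h5 : ∫ x, x i * x m ∂P = -∫ x, lin w x * x m ∂P := by
    have e1 := integral_condExp (μ := P)
      (f := (fun x : EuclideanSpace ℝ (Fin p) => x i) * fun x => x m) (sigmaAlg_le K)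
    have e2 := integral_condExp (μ := P) (f := lin w * fun x => x m) (sigmaAlg_le K)
    simp only [Pi.mul_apply] at e1 e2
    rw [← e1, ← e2, ← integral_neg]
    refine integral_congr_ae ?_
    filter_upwards [h2, h3, h4] with x h2 h3 h4
    rw [h2, h4, Pi.mul_apply, Pi.mul_apply, h3, Pi.neg_apply, neg_mul]
  have h6 : ∫ x, lin a x * lin (Pi.single m 1) x ∂P = 0 := by
    simp only [hlin, lin_single, Pi.add_apply, add_mul]
    have := integral_add ((hX i).integrable_mul (hX m)) (hw2.integrable_mul (hX m))
    simp only [Pi.mul_apply] at this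
    rw [this, h5, neg_add_cancel]
  simp_rw [mul_comm (lin a _)] at h6
  rw [integral_lin_mul_lin hS] at h6
  simpa using h6

end Population

end DagCov

namespace DagCov

/-! ### Tail bounds for Gaussian sums and sample variances -/

section GaussianTail

open scoped NNReal

theorem integrable_exp_mul_sq_gaussianReal {v : ℝ≥0} {t : ℝ} (h : 2 * t * v < 1) :
    Integrable (fun x => Real.exp (t * x ^ 2)) (gaussianReal 0 v) ∧
      ∫ x, Real.exp (t * x ^ 2) ∂(gaussianReal 0 v) = (√(1 - 2 * t * v))⁻¹ := by
  by_cases hv : v = 0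
  · subst hv
    simp [gaussianReal_zero_var, integrable_dirac]
  have hv' : (0 : ℝ) < v := by positivity
  have hb : 0 < 1 / (2 * (v : ℝ)) - t := by
    rw [sub_pos, lt_div_iff₀ (by positivity)]
    linarith
  have heq : ∀ x, gaussianPDFReal 0 v x * Real.exp (t * x ^ 2) =
      (√(2 * Real.pi * v))⁻¹ * Real.exp (-(1 / (2 * (v : ℝ)) - t) * x ^ 2) := by
    intro x
    rw [gaussianPDFReal, mul_assoc, ← Real.exp_add]
    congr 2
    field_simp
    ring
  constructor
  · rw [gaussianReal_of_var_ne_zero _ hv, integrable_withDensity_iff_integrable_smul₀'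
      (measurable_gaussianPDF 0 v).aemeasurable (.of_forall fun _ => gaussianPDF_lt_top)]
    simp only [toReal_gaussianPDF, smul_eq_mul, heq]
    exact (integrable_exp_neg_mul_sq hb).const_mul _
  · rw [integral_gaussianReal_eq_integral_smul hv]
    simp only [smul_eq_mul, heq]
    rw [integral_const_mul, integral_gaussian, ← Real.sqrt_inv, ← Real.sqrt_inv,
      ← Real.sqrt_mul (by positivity)]
    congr 1
    have : 1 - 2 * t * v ≠ 0 := by linarith
    have h2 : 1 / (2 * (v : ℝ)) - t = (1 - 2 * t * v) / (2 * v) := by field_simp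
    rw [h2]
    field_simp

/-- Equivalent to -log(1 - y) ≤ y + y². It bounds the chi-square moment generating function (1 -
2x)^(-1/2) by taking y = 2x. -/
theorem one_le_exp_mul_one_sub {y : ℝ} (hy : |y| ≤ 1 / 2) : 1 ≤ Real.exp (y + y ^ 2) * (1 - y) := by
  obtain ⟨h1, h2⟩ := abs_le.1 hy
  rcases le_total 0 y with h | h
  · have := Real.quadratic_le_exp_of_nonneg (x := y + y ^ 2) (by positivity)
    have h3 : 1 ≤ (1 + (y + y ^ 2) + (y + y ^ 2) ^ 2 / 2) * (1 - y) := by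
      have : 0 ≤ (1 - y) * (1 + y) ^ 2 / 2 - y := by nlinarith [mul_nonneg h h]
      nlinarith [mul_nonneg (sq_nonneg y) this]
    exact h3.trans (mul_le_mul_of_nonneg_right this (by linarith))
  · have := Real.add_one_le_exp (y + y ^ 2)
    have h3 : 1 ≤ (y + y ^ 2 + 1) * (1 - y) := by
      nlinarith [mul_nonneg (sq_nonneg y) (neg_nonneg.2 h)]
    exact h3.trans (mul_le_mul_of_nonneg_right this (by linarith))

theorem inv_sqrt_one_sub_le {x : ℝ} (hx : |x| ≤ 1 / 4) :
    (√(1 - 2 * x))⁻¹ ≤ Real.exp (x + 2 * x ^ 2) := by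
  obtain ⟨h1, h2⟩ := abs_le.1 hx
  have h := one_le_exp_mul_one_sub (y := 2 * x) (by rw [abs_mul, abs_two]; linarith)
  rw [inv_le_comm₀ (Real.sqrt_pos.2 (by linarith)) (Real.exp_pos _)]
  refine Real.le_sqrt_of_sq_le ?_
  rw [inv_pow, inv_le_comm₀ (by positivity) (by linarith), ← one_div,
    div_le_iff₀ (by linarith), ← Real.exp_nat_mul]
  rwa [show ((2 : ℕ) : ℝ) * (x + 2 * x ^ 2) = 2 * x + (2 * x) ^ 2 by push_cast; ring]

variable {Ω : Type*} {mΩ : MeasurableSpace Ω} {P : Measure Ω} {n : ℕ} {Y : Fin n → Ω → ℝ} {v : ℝ≥0}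

theorem mgf_sum_sq_le (hY : ∀ k, HasLaw (Y k) (gaussianReal 0 v) P) (hind : iIndepFun Y P) {t : ℝ}
    (ht : |t * v| ≤ 1 / 4) :
    Integrable (fun ω => Real.exp (t * ∑ k, Y k ω ^ 2)) P ∧
      mgf (fun ω => ∑ k, Y k ω ^ 2) P t ≤ Real.exp (n * (t * v + 2 * (t * v) ^ 2)) := by
  have ht' : 2 * t * v < 1 := by linarith [(abs_le.1 ht).2]
  have hind2 : iIndepFun (fun k ω => Y k ω ^ 2) P :=
    hind.comp (fun _ y => y ^ 2) (fun _ => by fun_prop)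
  have hm : ∀ k, AEMeasurable (fun ω => Y k ω ^ 2) P := fun k => (hY k).aemeasurable.pow_const 2
  have hmgf : ∀ k, mgf (fun ω => Y k ω ^ 2) P t ≤ Real.exp (t * v + 2 * (t * v) ^ 2) := fun k => by
    have := (hY k).integral_comp (f := fun x => Real.exp (t * x ^ 2))
      (by fun_prop)
    rw [(integrable_exp_mul_sq_gaussianReal ht').2] at this
    simp only [mgf]
    refine (this.trans_le ?_)
    have := inv_sqrt_one_sub_le ht
    rwa [← mul_assoc] at this
  have hsum : (fun ω => ∑ k, Y k ω ^ 2) = ∑ k, fun ω => Y k ω ^ 2 := by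
    ext ω
    simp
  constructor
  · have h1 : Integrable (fun y : Fin n → ℝ => ∏ k, Real.exp (t * y k ^ 2))
        (Measure.pi fun _ => gaussianReal 0 v) :=
      Integrable.fintype_prod fun _ => (integrable_exp_mul_sq_gaussianReal ht').1
    have hlaw := hind.hasLaw_pi hY
    rw [← hlaw.map_eq] at h1
    refine (h1.comp_aemeasurable hlaw.aemeasurable).congr (.of_forall fun ω => ?_)
    simp only [Function.comp, ← Real.exp_sum, Finset.mul_sum]
  · rw [hsum, hind2.mgf_sum₀ hm]
    refine (Finset.prod_le_prod (fun k _ => mgf_nonneg) fun k _ => hmgf k).trans_eq ?_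
    rw [Finset.prod_const, Finset.card_univ, Fintype.card_fin, ← Real.exp_nat_mul]

theorem measureReal_sum_sq_sub_ge_le (hY : ∀ k, HasLaw (Y k) (gaussianReal 0 v) P)
    (hind : iIndepFun Y P) (hv : v ≠ 0) {δ : ℝ} (hδ : 0 < δ) (hδ1 : δ ≤ 1) :
    P.real {ω | n * v * δ ≤ |∑ k, Y k ω ^ 2 - n * v|} ≤ 2 * Real.exp (-(n * δ ^ 2 / 8)) := by
  have : IsProbabilityMeasure P := hind.isProbabilityMeasure
  have hv' : (0 : ℝ) < v := by positivity
  have e1 : δ / (4 * v) * v = δ / 4 := by field_simp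
  have e2 : -(δ / (4 * v)) * v = -(δ / 4) := by field_simp
  -- Chernoff's method: t v = ±δ / 4 minimises 2 (t v)² - δ |t v|, with minimum -δ² / 8.
  obtain ⟨i1, b1⟩ := mgf_sum_sq_le hY hind (t := δ / (4 * v)) (by
    rw [e1, abs_of_pos (by positivity)]; linarith)
  obtain ⟨i2, b2⟩ := mgf_sum_sq_le hY hind (t := -(δ / (4 * v))) (by
    rw [e2, abs_neg, abs_of_pos (by positivity)]; linarith)
  have c1 := measure_ge_le_exp_mul_mgf (n * v * (1 + δ)) (by positivity) i1
  have c2 := measure_le_le_exp_mul_mgf (n * v * (1 - δ))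
    (neg_nonpos.2 (by positivity : 0 ≤ δ / (4 * v))) i2
  have d1 : P.real {ω | n * v * (1 + δ) ≤ ∑ k, Y k ω ^ 2} ≤ Real.exp (-(n * δ ^ 2 / 8)) := by
    refine c1.trans ((mul_le_mul_of_nonneg_left b1 (Real.exp_pos _).le).trans_eq ?_)
    rw [← Real.exp_add, e1]
    congr 1
    field_simp
    ring
  have d2 : P.real {ω | ∑ k, Y k ω ^ 2 ≤ n * v * (1 - δ)} ≤ Real.exp (-(n * δ ^ 2 / 8)) := by
    refine c2.trans ((mul_le_mul_of_nonneg_left b2 (Real.exp_pos _).le).trans_eq ?_)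
    rw [← Real.exp_add, e2]
    congr 1
    field_simp
    ring
  have hsub : {ω | n * v * δ ≤ |∑ k, Y k ω ^ 2 - n * v|} ⊆
      {ω | n * v * (1 + δ) ≤ ∑ k, Y k ω ^ 2} ∪ {ω | ∑ k, Y k ω ^ 2 ≤ n * v * (1 - δ)} := by
    intro ω hω
    simp only [Set.mem_ofPred_eq, Set.mem_union] at hω ⊢
    rcases le_abs.1 hω with h | h
    · left; linarith
    · right; linarith
  have := (measureReal_mono hsub).trans (measureReal_union_le (μ := P) _ _)
  linarith

/-- Tail bound for a linear combination of independent centred Gaussian variables. -/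
theorem measureReal_le_abs_sum_mul_le (hY : ∀ k, HasLaw (Y k) (gaussianReal 0 v) P)
    (hind : iIndepFun Y P) {c : Fin n → ℝ} {s τ : ℝ} (hc : v * ∑ k, c k ^ 2 ≤ s)
    (hτ : 0 ≤ τ) :
    P.real {ω | τ ≤ |∑ k, c k * Y k ω|} ≤ 2 * Real.exp (-(τ ^ 2 / (2 * s))) := by
  have : IsProbabilityMeasure P := hind.isProbabilityMeasure
  have hsub : ∀ k, HasSubgaussianMGF (Y k) v P := fun k =>
    { integrable_exp_mul := fun t => by
        have := integrable_exp_mul_gaussianReal (μ := 0) (v := v) t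
        rw [← (hY k).map_eq] at this
        exact this.comp_aemeasurable (hY k).aemeasurable
      mgf_le := fun t => by
        rw [mgf_gaussianReal (hY k).map_eq]
        simp }
  have hind2 : iIndepFun (fun k ω => c k * Y k ω) P :=
    hind.comp (fun k y => c k * y) (fun _ => by fun_prop)
  have hcsub : ∀ k, HasSubgaussianMGF (fun ω => c k * Y k ω) (v * (c k ^ 2).toNNReal) P := fun k =>
    { integrable_exp_mul := fun t => by
        simpa only [mul_assoc] using (hsub k).integrable_exp_mul (t * c k)
      mgf_le := fun t => by
        rw [mgf_const_mul, NNReal.coe_mul, Real.coe_toNNReal _ (sq_nonneg _)]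
        refine ((hsub k).mgf_le (c k * t)).trans_eq ?_
        ring_nf }
  have hS := HasSubgaussianMGF.sum_of_iIndepFun hind2 (s := Finset.univ) fun k _ => hcsub k
  have hexp : ∀ {a : ℝ≥0}, (a : ℝ) = v * ∑ k, c k ^ 2 → ∀ {Z : Ω → ℝ}, HasSubgaussianMGF Z a P →
      P.real {ω | τ ≤ Z ω} ≤ Real.exp (-(τ ^ 2 / (2 * s))) := by
    intro a ha Z hZ
    -- Comparing the exponents needs a positive variance proxy. If it is zero, `Z` vanishes almost
    -- surely.
    rcases eq_or_ne a 0 with h0 | h0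
    · subst h0
      rcases hτ.eq_or_lt with h | h
      · subst h
        simp [measureReal_le_one]
      · have hz := hZ.ae_eq_zero_of_hasSubgaussianMGF_zero
        have : P.real {ω | τ ≤ Z ω} = 0 := by
          rw [measureReal_eq_zero_iff, ← compl_compl {ω | τ ≤ Z ω}, ← mem_ae_iff]
          filter_upwards [hz] with ω hω
          simpa [hω] using h
        rw [this]
        positivity
    · refine (hZ.measure_ge_le hτ).trans (Real.exp_le_exp.2 ?_)
      rw [neg_div, neg_le_neg_iff]
      refine div_le_div_of_nonneg_left (by positivity) (by positivity) ?_
      rw [ha]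
      linarith
  have hcoe : ((∑ k, v * (c k ^ 2).toNNReal : ℝ≥0) : ℝ) = v * ∑ k, c k ^ 2 := by
    rw [NNReal.coe_sum, Finset.mul_sum]
    exact Finset.sum_congr rfl fun k _ => by
      rw [NNReal.coe_mul, Real.coe_toNNReal _ (sq_nonneg _)]
  have h1 := hexp hcoe hS
  have h2 := hexp hcoe hS.neg
  have hset : {ω | τ ≤ |∑ k, c k * Y k ω|} ⊆
      {ω | τ ≤ ∑ k, c k * Y k ω} ∪ {ω | τ ≤ (-fun ω => ∑ k, c k * Y k ω) ω} := by
    intro ω hω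
    simpa [le_abs] using hω
  have := (measureReal_mono hset).trans (measureReal_union_le (μ := P) _ _)
  linarith

/-- Concentration of the sample variance of independent centred Gaussian variables. -/
theorem measureReal_sampleVar_sub_gt_le (hY : ∀ k, HasLaw (Y k) (gaussianReal 0 v) P)
    (hind : iIndepFun Y P) (hv : v ≠ 0) (hn : 0 < n) {δ : ℝ} (hδ : 0 < δ) (hδ1 : δ ≤ 1) :
    P.real {ω | v * δ < |(n : ℝ)⁻¹ * ∑ k, (Y k ω - (n : ℝ)⁻¹ * ∑ l, Y l ω) ^ 2 - v|} ≤
      4 * Real.exp (-(n * δ ^ 2 / 32)) := by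
  have : IsProbabilityMeasure P := hind.isProbabilityMeasure
  have hv' : (0 : ℝ) < v := by positivity
  have hn' : (0 : ℝ) < n := by positivity
  -- Half of the deviation is allotted to the raw second moment and half to the squared mean, which
  -- reaches v δ / 2 exactly when the sum reaches n √(v δ / 2) in absolute value.
  have h1 := measureReal_sum_sq_sub_ge_le hY hind hv (δ := δ / 2) (by positivity) (by linarith)
  have h2 := measureReal_le_abs_sum_mul_le hY hind (c := fun _ => 1) (s := v * n)
    (τ := n * √(v * δ / 2)) (by simp) (by positivity)
  have e1 : (n : ℝ) * (δ / 2) ^ 2 / 8 = n * δ ^ 2 / 32 := by ring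
  have e2 : n * δ ^ 2 / 32 ≤ (n * √(v * δ / 2)) ^ 2 / (2 * (v * n)) := by
    rw [mul_pow, Real.sq_sqrt (by positivity)]
    have : (n : ℝ) ^ 2 * (v * δ / 2) / (2 * (v * n)) = n * δ / 4 := by field_simp; norm_num
    rw [this]
    have : δ ^ 2 ≤ δ := by nlinarith
    nlinarith
  rw [e1] at h1
  have h2' := h2.trans (mul_le_mul_of_nonneg_left
    (Real.exp_le_exp.2 (neg_le_neg e2)) zero_le_two)
  have hset : {ω | v * δ < |(n : ℝ)⁻¹ * ∑ k, (Y k ω - (n : ℝ)⁻¹ * ∑ l, Y l ω) ^ 2 - v|} ⊆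
      {ω | n * v * (δ / 2) ≤ |∑ k, Y k ω ^ 2 - n * v|} ∪
        {ω | n * √(v * δ / 2) ≤ |∑ k, 1 * Y k ω|} := by
    intro ω hω
    by_contra hcon
    simp only [Set.mem_union, Set.mem_ofPred_eq, not_or, not_le, one_mul] at hcon hω
    obtain ⟨g1, g2⟩ := hcon
    set T := ∑ k, Y k ω
    have hq : ∑ k, (Y k ω - (n : ℝ)⁻¹ * T) ^ 2 = ∑ k, Y k ω ^ 2 - (n : ℝ)⁻¹ * T ^ 2 := by
      simp only [sub_sq, Finset.sum_add_distrib, Finset.sum_sub_distrib, Finset.sum_const,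
        Finset.card_univ, Fintype.card_fin, nsmul_eq_mul, ← Finset.sum_mul, ← Finset.mul_sum]
      field_simp
      ring
    have g3 : ((n : ℝ)⁻¹ * T) ^ 2 < v * δ / 2 := by
      have : |(n : ℝ)⁻¹ * T| < √(v * δ / 2) := by
        rw [abs_mul, abs_of_pos (by positivity : (0 : ℝ) < (n : ℝ)⁻¹), inv_mul_lt_iff₀ hn']
        exact g2
      rw [← sq_abs]
      exact (Real.lt_sqrt (abs_nonneg _)).1 this
    have g4 : |(n : ℝ)⁻¹ * ∑ k, Y k ω ^ 2 - v| < v * δ / 2 := by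
      have : (n : ℝ)⁻¹ * ∑ k, Y k ω ^ 2 - v = (n : ℝ)⁻¹ * (∑ k, Y k ω ^ 2 - n * v) := by
        field_simp
      rw [this, abs_mul, abs_of_pos (by positivity : (0 : ℝ) < (n : ℝ)⁻¹), inv_mul_lt_iff₀ hn']
      linarith
    rw [hq] at hω
    have g5 : (n : ℝ)⁻¹ * (∑ k, Y k ω ^ 2 - (n : ℝ)⁻¹ * T ^ 2) - v =
        ((n : ℝ)⁻¹ * ∑ k, Y k ω ^ 2 - v) - ((n : ℝ)⁻¹ * T) ^ 2 := by ring
    rw [g5] at hω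
    have := (abs_sub _ _).trans_lt' hω
    rw [abs_of_nonneg (sq_nonneg ((n : ℝ)⁻¹ * T))] at this
    linarith
  have := (measureReal_mono hset).trans (measureReal_union_le (μ := P) _ _)
  linarith

/-- Tail bound for a linear combination of independent centred Gaussian variables whose
coefficients are functions of an independent random variable. -/
theorem measureReal_le_abs_sum_mul_le_of_indepFun {E : Type*} [MeasurableSpace E] {W : Ω → E}
    (hY : ∀ k, HasLaw (Y k) (gaussianReal 0 v) P) (hind : iIndepFun Y P) (hW : AEMeasurable W P)
    (hWY : IndepFun W (fun ω k => Y k ω) P) {c : E → Fin n → ℝ} (hc : Measurable c) {s τ : ℝ}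
    (hτ : 0 ≤ τ) :
    P.real {ω | v * ∑ k, c (W ω) k ^ 2 ≤ s ∧ τ ≤ |∑ k, c (W ω) k * Y k ω|} ≤
      2 * Real.exp (-(τ ^ 2 / (2 * s))) := by
  have : IsProbabilityMeasure P := hind.isProbabilityMeasure
  have hYm : AEMeasurable (fun ω k => Y k ω) P :=
    aemeasurable_pi_lambda _ fun k => (hY k).aemeasurable
  have := Measure.isProbabilityMeasure_map (μ := P) hW
  have := Measure.isProbabilityMeasure_map (μ := P) hYm
  set B : Set (E × (Fin n → ℝ)) :=
    {z | v * ∑ k, c z.1 k ^ 2 ≤ s ∧ τ ≤ |∑ k, c z.1 k * z.2 k|} with hB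
  have hck : ∀ k, Measurable fun z : E × (Fin n → ℝ) => c z.1 k := fun k =>
    (measurable_pi_apply k).comp (hc.comp measurable_fst)
  have hBm : MeasurableSet B := by
    have m1 : MeasurableSet {z : E × (Fin n → ℝ) | v * ∑ k, c z.1 k ^ 2 ≤ s} :=
      measurableSet_le (by fun_prop) measurable_const
    have m2 : MeasurableSet {z : E × (Fin n → ℝ) | τ ≤ |∑ k, c z.1 k * z.2 k|} :=
      measurableSet_le measurable_const (by fun_prop)
    exact m1.inter m2
  have hlaw : P.map (fun ω => (W ω, fun k => Y k ω)) = (P.map W).prod (P.map fun ω k => Y k ω) :=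
    (indepFun_iff_map_prod_eq_prod_map_map hW hYm).1 hWY
  have hPB : P {ω | v * ∑ k, c (W ω) k ^ 2 ≤ s ∧ τ ≤ |∑ k, c (W ω) k * Y k ω|} ≤
      ENNReal.ofReal (2 * Real.exp (-(τ ^ 2 / (2 * s)))) := by
    have h1 : P {ω | v * ∑ k, c (W ω) k ^ 2 ≤ s ∧ τ ≤ |∑ k, c (W ω) k * Y k ω|} =
        P.map (fun ω => (W ω, fun k => Y k ω)) B := by
      rw [Measure.map_apply_of_aemeasurable (hW.prodMk hYm) hBm]
      rfl
    rw [h1, hlaw, Measure.prod_apply hBm]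
    -- By independence the coefficients can be frozen at `c w`. The bound for fixed coefficients is
    -- uniform in `w`, and a slice violating the variance constraint is empty.
    have h2 : ∀ w, (P.map fun ω k => Y k ω) (Prod.mk w ⁻¹' B) ≤
        ENNReal.ofReal (2 * Real.exp (-(τ ^ 2 / (2 * s)))) := by
      intro w
      rw [Measure.map_apply_of_aemeasurable hYm (measurable_prodMk_left hBm)]
      by_cases hw : v * ∑ k, c w k ^ 2 ≤ s
      · have := measureReal_le_abs_sum_mul_le hY hind hw hτ
        rw [← ofReal_measureReal]
        refine ENNReal.ofReal_le_ofReal (le_trans (measureReal_mono fun ω hω => ?_) this)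
        exact hω.2
      · have : (fun ω k => Y k ω) ⁻¹' (Prod.mk w ⁻¹' B) = ∅ := by
          ext ω
          simp [hB, hw]
        rw [this]
        simp
    refine (lintegral_mono h2).trans ?_
    simp
  exact ENNReal.toReal_le_of_le_ofReal (by positivity) hPB

end GaussianTail

end DagCov

namespace DagCov

/-! ### Algebra of the normal equations -/

section Regression

variable {p : ℕ}

/-- Extension of a vector indexed by `K` by zero. -/
def extendZero (K : Finset (Fin p)) (w : K → ℝ) : Fin p → ℝ :=
  fun j => if h : j ∈ K then w ⟨j, h⟩ else 0

theorem extendZero_coe (K : Finset (Fin p)) (w : K → ℝ) (k : K) : extendZero K w k = w k := by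
  simp [extendZero]

theorem extendZero_of_notMem {K : Finset (Fin p)} (w : K → ℝ) {j : Fin p} (hj : j ∉ K) :
    extendZero K w j = 0 := by
  simp [extendZero, hj]

theorem extendZero_restrict {K : Finset (Fin p)} {w : Fin p → ℝ} (hw : ∀ j, j ∉ K → w j = 0) :
    extendZero K (fun k => w k) = w := by
  ext j
  by_cases hj : j ∈ K
  · simp [extendZero, hj]
  · simp [extendZero, hj, hw j hj]

theorem dotProduct_eq_sum_of_support {K : Finset (Fin p)} {w : Fin p → ℝ}
    (hw : ∀ j, j ∉ K → w j = 0) (u : Fin p → ℝ) : w ⬝ᵥ u = ∑ k ∈ K, w k * u k :=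
  (Finset.sum_subset (Finset.subset_univ K) fun j _ hj => by simp [hw j hj]).symm

theorem extendZero_dotProduct (K : Finset (Fin p)) (w : K → ℝ) (u : Fin p → ℝ) :
    extendZero K w ⬝ᵥ u = w ⬝ᵥ fun k : K => u k := by
  rw [dotProduct_eq_sum_of_support (fun j hj => extendZero_of_notMem w hj), ← Finset.sum_coe_sort]
  simp [dotProduct, extendZero_coe]

theorem dotProduct_mulVec_comm {S : Matrix (Fin p) (Fin p) ℝ} (hS : S.IsSymm)
    (u v : Fin p → ℝ) : u ⬝ᵥ S *ᵥ v = v ⬝ᵥ S *ᵥ u := by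
  rw [Matrix.dotProduct_mulVec, ← Matrix.mulVec_transpose, hS.eq, dotProduct_comm]

/-- The principal submatrix indexed by `K`. -/
abbrev principal (S : Matrix (Fin p) (Fin p) ℝ) (K : Finset (Fin p)) : Matrix K K ℝ :=
  S.submatrix (fun k : K => (k : Fin p)) (fun k : K => (k : Fin p))

theorem mulVec_extendZero (S : Matrix (Fin p) (Fin p) ℝ) (K : Finset (Fin p)) (w : K → ℝ) (k : K) :
    (S *ᵥ extendZero K w) k = (principal S K *ᵥ w) k := by
  rw [Matrix.mulVec, dotProduct_comm, extendZero_dotProduct, dotProduct_comm]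
  rfl

theorem extendZero_dotProduct_mulVec (S : Matrix (Fin p) (Fin p) ℝ) (K : Finset (Fin p))
    (u w : K → ℝ) :
    extendZero K u ⬝ᵥ S *ᵥ extendZero K w = u ⬝ᵥ principal S K *ᵥ w := by
  rw [extendZero_dotProduct]
  congr 1
  ext k
  exact mulVec_extendZero S K w k

theorem posDef_principal {S : Matrix (Fin p) (Fin p) ℝ} (hS : S.IsSymm) {K : Finset (Fin p)}
    (h : ∀ w : Fin p → ℝ, (∀ j, j ∉ K → w j = 0) → w ≠ 0 → 0 < w ⬝ᵥ S *ᵥ w) :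
    (principal S K).PosDef := by
  refine Matrix.PosDef.of_dotProduct_mulVec_pos ?_ fun w hw => ?_
  · ext k l
    simpa using hS.apply (k : Fin p) l
  · have h1 : extendZero K w ≠ 0 := by
      intro h0
      refine hw (funext fun k => ?_)
      rw [← extendZero_coe K w k, h0]
      rfl
    have := h _ (fun j hj => extendZero_of_notMem w hj) h1
    rw [extendZero_dotProduct_mulVec] at this
    simpa using this

/-- The vector of coefficients of the residual of the regression of variable `i` on the variables
in `K`. -/
noncomputable def resVec (S : Matrix (Fin p) (Fin p) ℝ) (i : Fin p) (K : Finset (Fin p)) :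
    Fin p → ℝ :=
  Pi.single i 1 - extendZero K (regCoef S i K)

theorem regMatrix_apply (S : Matrix (Fin p) (Fin p) ℝ) {G : Digraph (Fin p)} {i : Fin p}
    (hi : i ∉ pa G i) (j : Fin p) : regMatrix S G i j = resVec S i (pa G i) j := by
  by_cases hj : j ∈ pa G i
  · have hji : j ≠ i := fun h => hi (h ▸ hj)
    simp [regMatrix, resVec, extendZero, hj, hji]
  · by_cases hji : j = i
    · subst hji
      simp [regMatrix, resVec, extendZero, hj]
    · simp [regMatrix, resVec, extendZero, hj, hji]

variable {S : Matrix (Fin p) (Fin p) ℝ} {i : Fin p} {K : Finset (Fin p)}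

theorem resVec_self (hi : i ∉ K) : resVec S i K i = 1 := by
  simp [resVec, extendZero_of_notMem _ hi]

theorem resVec_of_notMem {j : Fin p} (hj : j ∉ K) (hji : j ≠ i) : resVec S i K j = 0 := by
  simp [resVec, extendZero_of_notMem _ hj, hji]

theorem mulVec_resVec_of_mem (hS : S.IsSymm) (hu : IsUnit (principal S K)) {k : Fin p}
    (hk : k ∈ K) : (S *ᵥ resVec S i K) k = 0 := by
  have h := congrFun (show regCoef S i K ᵥ* principal S K = fun k : K => S i k by
    rw [regCoef, Matrix.vecMul_vecMul,
      Matrix.nonsing_inv_mul _ ((Matrix.isUnit_iff_isUnit_det _).1 hu), Matrix.vecMul_one]) ⟨k, hk⟩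
  have hp : (principal S K)ᵀ = principal S K := by
    ext a b
    exact hS.apply _ _
  rw [← Matrix.mulVec_transpose, hp] at h
  rw [resVec, Matrix.mulVec_sub, Pi.sub_apply, mulVec_extendZero S K _ ⟨k, hk⟩, h]
  simp [hS.apply i k]

theorem resVec_dotProduct_of_eq_zero {u : Fin p → ℝ} (hu : ∀ k ∈ K, u k = 0) :
    resVec S i K ⬝ᵥ u = u i := by
  rw [resVec, sub_dotProduct, extendZero_dotProduct]
  have : (fun k : K => u k) = 0 := funext fun k => hu k k.2
  simp [this]

theorem residVar_eq (hS : S.IsSymm) (hu : IsUnit (principal S K)) :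
    residVar S i K = resVec S i K ⬝ᵥ S *ᵥ resVec S i K := by
  rw [resVec_dotProduct_of_eq_zero fun k hk => mulVec_resVec_of_mem hS hu hk]
  have h : (S *ᵥ extendZero K (regCoef S i K)) i = regCoef S i K ⬝ᵥ fun k : K => S k i := by
    rw [Matrix.mulVec, dotProduct_comm, extendZero_dotProduct]
    congr 1
    ext k
    exact (hS.apply _ _)
  rw [residVar, resVec, Matrix.mulVec_sub, Pi.sub_apply, h]
  simp

theorem resVec_sub_resVec_of_notMem {T : Matrix (Fin p) (Fin p) ℝ} {j : Fin p} (hj : j ∉ K) :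
    (resVec T i K - resVec S i K) j = 0 := by
  simp [resVec, extendZero_of_notMem _ hj]

/-- The column `j` of the inverse of the principal submatrix indexed by `K`. -/
noncomputable def invCol (S : Matrix (Fin p) (Fin p) ℝ) (K : Finset (Fin p)) (j : K) :
    Fin p → ℝ :=
  extendZero K fun k => (principal S K)⁻¹ k j

theorem mulVec_invCol (hu : IsUnit (principal S K)) (j : K) (k : K) :
    (S *ᵥ invCol S K j) k = if k = j then 1 else 0 := by
  rw [invCol, mulVec_extendZero]
  have := congrFun (congrFun (Matrix.mul_nonsing_inv _ ((Matrix.isUnit_iff_isUnit_det _).1 hu)) k) j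
  rw [Matrix.one_apply] at this
  exact this

theorem dotProduct_mulVec_invCol (hu : IsUnit (principal S K)) {w : Fin p → ℝ}
    (hw : ∀ j, j ∉ K → w j = 0) (j : K) : w ⬝ᵥ S *ᵥ invCol S K j = w j := by
  rw [dotProduct_eq_sum_of_support hw, ← Finset.sum_coe_sort]
  simp [mulVec_invCol hu]

theorem dotProduct_mulVec_resVec (hS : S.IsSymm) (hu : IsUnit (principal S K)) {w : Fin p → ℝ}
    (hw : ∀ j, j ∉ K → w j = 0) : w ⬝ᵥ S *ᵥ resVec S i K = 0 := by
  rw [dotProduct_eq_sum_of_support hw]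
  exact Finset.sum_eq_zero fun k hk => by rw [mulVec_resVec_of_mem hS hu hk, mul_zero]

/-- The error of the regression coefficients of `T` as a bilinear form in `T`. -/
theorem resVec_sub_resVec_apply {T : Matrix (Fin p) (Fin p) ℝ} (hT : T.IsSymm)
    (hu : IsUnit (principal T K)) (j : K) :
    (resVec T i K - resVec S i K) j = -(invCol T K j ⬝ᵥ T *ᵥ resVec S i K) := by
  -- Pairing through `T` with column `j` of the inverse reads off coordinate `j`. The normal
  -- equations then remove the term containing `resVec T i K`.
  rw [← dotProduct_mulVec_invCol hu (fun _ hj => resVec_sub_resVec_of_notMem hj) j,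
    dotProduct_mulVec_comm hT, Matrix.mulVec_sub, dotProduct_sub,
    dotProduct_mulVec_resVec (w := invCol T K j) hT hu fun _ hj => extendZero_of_notMem _ hj,
    zero_sub]

/-- The difference of the two residual vectors is supported in `K`, hence `T`-orthogonal to `resVec
T i K`. The correction term pairs two small quantities, so it is of second order. -/
theorem resVec_dotProduct_mulVec_eq {T : Matrix (Fin p) (Fin p) ℝ} (hT : T.IsSymm)
    (hu : IsUnit (principal T K)) :
    resVec T i K ⬝ᵥ T *ᵥ resVec T i K = resVec S i K ⬝ᵥ T *ᵥ resVec S i K +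
      ∑ k ∈ K, (resVec T i K - resVec S i K) k * (T *ᵥ resVec S i K) k := by
  set d := resVec T i K - resVec S i K with hd
  have hdK : ∀ j, j ∉ K → d j = 0 := fun _ hj => resVec_sub_resVec_of_notMem hj
  rw [← dotProduct_eq_sum_of_support hdK]
  have h1 : resVec T i K = resVec S i K + d := by rw [hd, add_sub_cancel]
  have h2 : d ⬝ᵥ T *ᵥ resVec T i K = 0 := dotProduct_mulVec_resVec hT hu hdK
  have h3 : resVec T i K ⬝ᵥ T *ᵥ resVec T i K = resVec S i K ⬝ᵥ T *ᵥ resVec T i K := by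
    nth_rewrite 1 [h1]
    rw [add_dotProduct, h2, add_zero]
  rw [h3, dotProduct_mulVec_comm hT]
  nth_rewrite 1 [h1]
  rw [add_dotProduct]

open scoped MatrixOrder in
/-- A basis of the vectors supported in `K` which is orthonormal for a positive definite form. -/
theorem exists_orthonormal_basis (h : (principal S K).PosDef) :
    ∃ b : K → Fin p → ℝ, (∀ j l, b j ⬝ᵥ S *ᵥ b l = if j = l then 1 else 0) ∧
      ∀ w : Fin p → ℝ, (∀ j, j ∉ K → w j = 0) → ∃ c : K → ℝ, w = ∑ j, c j • b j := by
  -- Factor the principal block as Cᵀ C. The columns of C⁻¹ form the basis, and C w gives the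
  -- coordinates of w.
  obtain ⟨C, hC⟩ := CStarAlgebra.nonneg_iff_eq_star_mul_self.1 h.posSemidef.nonneg
  rw [Matrix.star_eq_conjTranspose, Matrix.conjTranspose_eq_transpose_of_trivial] at hC
  have hCu : IsUnit C.det := by
    have := (Matrix.isUnit_iff_isUnit_det _).1 h.isUnit
    rw [hC, Matrix.det_mul] at this
    exact isUnit_of_mul_isUnit_right this
  refine ⟨fun j => extendZero K fun k => C⁻¹ k j, fun j l => ?_, fun w hw => ?_⟩
  · rw [extendZero_dotProduct_mulVec]
    have h1 : (C⁻¹)ᵀ * principal S K * C⁻¹ = 1 := by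
      rw [hC, Matrix.mul_assoc, Matrix.mul_assoc, Matrix.mul_nonsing_inv _ hCu, Matrix.mul_one,
        ← Matrix.transpose_mul, Matrix.mul_nonsing_inv _ hCu, Matrix.transpose_one]
    have h2 := congrFun (congrFun h1 j) l
    rw [Matrix.one_apply, Matrix.mul_assoc] at h2
    exact h2
  · refine ⟨C *ᵥ fun k => w k, ?_⟩
    have h1 : C⁻¹ *ᵥ C *ᵥ (fun k : K => w k) = fun k : K => w k := by
      rw [Matrix.mulVec_mulVec, Matrix.nonsing_inv_mul _ hCu, Matrix.one_mulVec]
    rw [← extendZero_restrict hw]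
    nth_rewrite 1 [← h1]
    ext j
    by_cases hj : j ∈ K
    · simp [extendZero, hj, Matrix.mulVec, dotProduct, mul_comm]
    · simp [extendZero, hj]

theorem sum_smul_dotProduct_mulVec (T : Matrix (Fin p) (Fin p) ℝ) {ι : Type*} [Fintype ι]
    (b : ι → Fin p → ℝ) (c : ι → ℝ) :
    (∑ j, c j • b j) ⬝ᵥ T *ᵥ (∑ j, c j • b j) =
      ∑ j, ∑ l, c j * c l * (b j ⬝ᵥ T *ᵥ b l) := by
  rw [sum_dotProduct, Matrix.mulVec_sum]
  refine Finset.sum_congr rfl fun j _ => ?_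
  rw [dotProduct_sum]
  refine Finset.sum_congr rfl fun l _ => ?_
  rw [Matrix.mulVec_smul, dotProduct_smul, smul_dotProduct, smul_eq_mul, smul_eq_mul]
  ring

/-- If two forms are close on an orthonormal basis, then they are comparable. -/
theorem dotProduct_mulVec_le_two_mul {T : Matrix (Fin p) (Fin p) ℝ} {b : K → Fin p → ℝ}
    (hb : ∀ j l, b j ⬝ᵥ S *ᵥ b l = if j = l then 1 else 0) {η : ℝ}
    (hη : ∀ j l, |b j ⬝ᵥ T *ᵥ b l - b j ⬝ᵥ S *ᵥ b l| ≤ η) (hK : K.card * η ≤ 1 / 2)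
    {w : Fin p → ℝ} {c : K → ℝ} (hw : w = ∑ j, c j • b j) :
    w ⬝ᵥ S *ᵥ w ≤ 2 * (w ⬝ᵥ T *ᵥ w) := by
  have e1 : w ⬝ᵥ S *ᵥ w = ∑ j, c j ^ 2 := by
    rw [hw, sum_smul_dotProduct_mulVec]
    simp [hb, sq]
  -- From |c_j c_l| ≤ (c_j² + c_l²) / 2: an entrywise error η perturbs the form by at most |K| η
  -- relative to the identity.
  have e2 : |w ⬝ᵥ T *ᵥ w - w ⬝ᵥ S *ᵥ w| ≤ K.card * η * ∑ j, c j ^ 2 := by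
    rw [hw, sum_smul_dotProduct_mulVec, sum_smul_dotProduct_mulVec, ← Finset.sum_sub_distrib]
    simp_rw [← Finset.sum_sub_distrib, ← mul_sub]
    calc |∑ j, ∑ l, c j * c l * (b j ⬝ᵥ T *ᵥ b l - b j ⬝ᵥ S *ᵥ b l)|
        ≤ ∑ j, ∑ l, (c j ^ 2 + c l ^ 2) / 2 * η := by
          refine (Finset.abs_sum_le_sum_abs _ _).trans (Finset.sum_le_sum fun j _ => ?_)
          refine (Finset.abs_sum_le_sum_abs _ _).trans (Finset.sum_le_sum fun l _ => ?_)
          rw [abs_mul]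
          refine mul_le_mul ?_ (hη j l) (abs_nonneg _) (by positivity)
          rw [abs_mul]
          nlinarith [sq_nonneg (|c j| - |c l|), sq_abs (c j), sq_abs (c l)]
      _ = K.card * η * ∑ j, c j ^ 2 := by
          simp_rw [← Finset.sum_mul, ← Finset.sum_div, Finset.sum_add_distrib, Finset.sum_const,
            Finset.card_univ, Fintype.card_coe, nsmul_eq_mul, ← Finset.mul_sum]
          ring
  have e3 : K.card * η * ∑ j, c j ^ 2 ≤ 1 / 2 * ∑ j, c j ^ 2 :=
    mul_le_mul_of_nonneg_right hK (Finset.sum_nonneg fun _ _ => sq_nonneg _)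
  have := (abs_le.1 e2).1
  linarith

end Regression

end DagCov

namespace DagCov

/-! ### The factorisation of the concentration matrix -/

section Structure

variable {p : ℕ} {S : Matrix (Fin p) (Fin p) ℝ} {G : Digraph (Fin p)} {r : ℝ}

theorem isSymm_of_posSemidef (hS : S.PosSemidef) : S.IsSymm := by
  ext i j
  simpa using hS.isHermitian.apply i j

theorem CondVarBound.mul_sq_le (hS : S.PosSemidef)
    (h : CondVarBound (multivariateGaussian 0 S) G r) {i j : Fin p} (hj : j ∈ pa G i)
    {w : Fin p → ℝ} (hw : ∀ k, k ∉ pa G i → w k = 0) : r * w j ^ 2 ≤ w ⬝ᵥ S *ᵥ w :=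
  (h.1 i j hj).sq_mul_le hS (fun k hk hkj => hw k fun hk' => hk (Finset.mem_erase.2 ⟨hkj, hk'⟩))
    (Finset.notMem_erase j _)

theorem CondVarBound.dotProduct_pos (hS : S.PosSemidef) (hr : 0 < r)
    (h : CondVarBound (multivariateGaussian 0 S) G r) {i : Fin p}
    {w : Fin p → ℝ} (hw : ∀ k, k ∉ pa G i → w k = 0) (h0 : w ≠ 0) : 0 < w ⬝ᵥ S *ᵥ w := by
  obtain ⟨j, hj⟩ := Function.ne_iff.1 h0
  have hjK : j ∈ pa G i := by
    by_contra hjK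
    exact hj (hw j hjK)
  exact (mul_pos hr (sq_pos_of_ne_zero hj)).trans_le (h.mul_sq_le hS hjK hw)

theorem CondVarBound.posDef_principal (hS : S.PosSemidef) (hr : 0 < r)
    (h : CondVarBound (multivariateGaussian 0 S) G r) (i : Fin p) :
    (principal S (pa G i)).PosDef :=
  DagCov.posDef_principal (isSymm_of_posSemidef hS) fun _ hw h0 => h.dotProduct_pos hS hr hw h0

theorem CondVarBound.le_residVar (hS : S.PosSemidef) (hr : 0 < r)
    (h : CondVarBound (multivariateGaussian 0 S) G r) (i : Fin p) :
    r ≤ residVar S i (pa G i) := by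
  rw [residVar_eq (isSymm_of_posSemidef hS) (h.posDef_principal hS hr i).isUnit, resVec,
    sub_eq_add_neg]
  exact (h.2 i).le_dotProduct hS fun j hj => by simp [extendZero_of_notMem _ hj]

/-- The variance decomposes into the residual variance and the explained variance. -/
theorem residVar_add_eq {K : Finset (Fin p)} {i : Fin p} (hS : S.IsSymm)
    (hu : IsUnit (principal S K)) :
    residVar S i K + extendZero K (regCoef S i K) ⬝ᵥ S *ᵥ extendZero K (regCoef S i K) = S i i := by
  set β := extendZero K (regCoef S i K) with hβ
  have h1 : Pi.single i 1 = resVec S i K + β := by rw [resVec, sub_add_cancel]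
  have h2 : S i i = (Pi.single i 1 : Fin p → ℝ) ⬝ᵥ S *ᵥ Pi.single i 1 := by simp
  have h3 : β ⬝ᵥ S *ᵥ resVec S i K = 0 :=
    dotProduct_mulVec_resVec hS hu fun j hj => extendZero_of_notMem _ hj
  rw [h2, h1, Matrix.mulVec_add, add_dotProduct, dotProduct_add, dotProduct_add, h3,
    dotProduct_mulVec_comm hS (resVec S i K) β, h3, residVar_eq hS hu]
  ring

theorem CondVarBound.residVar_le (hS : S.PosSemidef) (hr : 0 < r)
    (h : CondVarBound (multivariateGaussian 0 S) G r) (i : Fin p) :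
    residVar S i (pa G i) ≤ S i i := by
  rw [← residVar_add_eq (isSymm_of_posSemidef hS) (h.posDef_principal hS hr i).isUnit]
  have := hS.dotProduct_mulVec_nonneg (extendZero (pa G i) (regCoef S i (pa G i)))
  simpa using this

/-- The explained variance is at most S_ii and at least r β_j², so β_j² ≤ S_ii / r. The bound 1 +
S_ii / r avoids a square root and also covers the diagonal entry 1. -/
theorem CondVarBound.abs_resVec_le (hS : S.PosSemidef) (hr : 0 < r)
    (h : CondVarBound (multivariateGaussian 0 S) G r) {i : Fin p} (hi : i ∉ pa G i) (j : Fin p) :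
    |resVec S i (pa G i) j| ≤ 1 + S i i / r := by
  have hpos : 0 ≤ S i i / r := by
    have := (h.le_residVar hS hr i).trans (h.residVar_le hS hr i)
    exact div_nonneg (hr.le.trans this) hr.le
  by_cases hj : j ∈ pa G i
  · have hji : j ≠ i := fun e => hi (e ▸ hj)
    have h1 := h.mul_sq_le hS hj
      (w := extendZero (pa G i) (regCoef S i (pa G i))) fun k hk => extendZero_of_notMem _ hk
    have h2 := residVar_add_eq (i := i) (isSymm_of_posSemidef hS)
      (h.posDef_principal hS hr i).isUnit
    have h3 := h.le_residVar hS hr i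
    have h4 : extendZero (pa G i) (regCoef S i (pa G i)) j ^ 2 ≤ S i i / r := by
      rw [le_div_iff₀ hr]
      linarith
    have h5 : resVec S i (pa G i) j = -extendZero (pa G i) (regCoef S i (pa G i)) j := by
      simp [resVec, hji]
    rw [h5, abs_neg]
    nlinarith [sq_abs (extendZero (pa G i) (regCoef S i (pa G i)) j),
      sq_nonneg (|extendZero (pa G i) (regCoef S i (pa G i)) j| - 1)]
  · by_cases hji : j = i
    · subst hji
      rw [resVec_self hi]
      simpa using hpos
    · rw [resVec_of_notMem hj hji]
      simp
      linarith

theorem mulVec_resVec_eq_zero_of_not_isDescendant (hS : S.PosSemidef) (hr : 0 < r)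
    (hG : IsDAG G) (hM : IsMarkov (multivariateGaussian 0 S) G)
    (h : CondVarBound (multivariateGaussian 0 S) G r) {i m : Fin p} (hmi : m ≠ i)
    (hm : ¬ IsDescendant G i m) : (S *ᵥ resVec S i (pa G i)) m = 0 := by
  have hi := hG.notMem_pa i
  have hu := (h.posDef_principal hS hr i).isUnit
  by_cases hmK : m ∈ pa G i
  · exact mulVec_resVec_of_mem (isSymm_of_posSemidef hS) hu hmK
  · refine mulVec_eq_zero_of_condIndepCoords hS (resVec_self hi)
      (fun j hj hji => resVec_of_notMem hj hji)
      (fun k hk => mulVec_resVec_of_mem (isSymm_of_posSemidef hS) hu hk)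
      (hM {i} {m} (pa G i) ?_ ?_ ?_ (dSep_pa hG hmi hmK hm))
    · simpa using hmi.symm
    · simpa using hi
    · simpa using hmK

theorem resVec_orthogonal (hS : S.PosSemidef) (hr : 0 < r)
    (hG : IsDAG G) (hM : IsMarkov (multivariateGaussian 0 S) G)
    (h : CondVarBound (multivariateGaussian 0 S) G r) {i j : Fin p} (hij : i ≠ j) :
    resVec S i (pa G i) ⬝ᵥ S *ᵥ resVec S j (pa G j) = 0 := by
  -- By acyclicity and symmetry, i may be taken not to be a descendant of j. Then neither are its
  -- parents, so the residual of j is uncorrelated with every variable entering the residual of i.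
  wlog hd : ¬ IsDescendant G j i generalizing i j
  · rw [dotProduct_mulVec_comm (isSymm_of_posSemidef hS)]
    exact this hij.symm ((hG.not_isDescendant_or j i).resolve_left hd)
  refine Finset.sum_eq_zero fun m _ => ?_
  by_cases hmi : m = i
  · subst hmi
    rw [mulVec_resVec_eq_zero_of_not_isDescendant hS hr hG hM h hij hd, mul_zero]
  by_cases hm : m ∈ pa G i
  · rw [mulVec_resVec_eq_zero_of_not_isDescendant hS hr hG hM h, mul_zero]
    · rintro rfl
      exact hd (.single (mem_pa.1 hm))
    · exact fun hjm => hd (hjm.tail (mem_pa.1 hm))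
  · rw [resVec_of_notMem hm hmi, zero_mul]

theorem regMatrix_mul_mul_transpose (hS : S.PosSemidef) (hr : 0 < r)
    (hG : IsDAG G) (hM : IsMarkov (multivariateGaussian 0 S) G)
    (h : CondVarBound (multivariateGaussian 0 S) G r) :
    regMatrix S G * S * (regMatrix S G)ᵀ = residCov S G := by
  have hrow : regMatrix S G = Matrix.of fun i => resVec S i (pa G i) := by
    ext i j
    exact regMatrix_apply S (hG.notMem_pa i) j
  ext i j
  have e : (regMatrix S G * S * (regMatrix S G)ᵀ) i j =
      resVec S i (pa G i) ⬝ᵥ S *ᵥ resVec S j (pa G j) := by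
    rw [hrow, Matrix.mul_assoc]
    rfl
  rw [e, residCov]
  by_cases hij : i = j
  · subst hij
    rw [Matrix.diagonal_apply_eq,
      residVar_eq (isSymm_of_posSemidef hS) (h.posDef_principal hS hr i).isUnit]
  · rw [Matrix.diagonal_apply_ne _ hij, resVec_orthogonal hS hr hG hM h hij]

/-- From A Σ Aᵀ = D with D invertible, A is a left inverse of Σ Aᵀ D⁻¹ up to order. The matrices
being square, the factors commute and Σ (Aᵀ D⁻¹ A) = 1, which yields the invertibility of Σ as well.
-/
theorem isUnit_and_concentration_eq_inv (hS : S.PosSemidef) (hr : 0 < r)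
    (hG : IsDAG G) (hM : IsMarkov (multivariateGaussian 0 S) G)
    (h : CondVarBound (multivariateGaussian 0 S) G r) :
    IsUnit S ∧ concentration S G = S⁻¹ := by
  have h1 := regMatrix_mul_mul_transpose hS hr hG hM h
  have hD : IsUnit (residCov S G).det := by
    rw [residCov, Matrix.det_diagonal, isUnit_iff_ne_zero, Finset.prod_ne_zero_iff]
    exact fun i _ => (hr.trans_le (h.le_residVar hS hr i)).ne'
  have h2 : regMatrix S G * (S * ((regMatrix S G)ᵀ * (residCov S G)⁻¹)) = 1 := by
    rw [← Matrix.mul_assoc, ← Matrix.mul_assoc, h1, Matrix.mul_nonsing_inv _ hD]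
  have h3 : S * concentration S G = 1 := by
    rw [concentration, ← Matrix.mul_assoc]
    exact mul_eq_one_comm.1 h2
  exact ⟨IsUnit.of_mul_eq_one _ h3, (Matrix.inv_eq_right_inv h3).symm⟩

end Structure

end DagCov

namespace DagCov

/-! ### Concentration of the sample covariance matrix -/

section Sample

open scoped NNReal

variable {p n : ℕ}

theorem isSymm_sampleCov (x : Fin n → EuclideanSpace ℝ (Fin p)) : (sampleCov x).IsSymm := by
  ext i j
  simp [sampleCov, mul_comm]

theorem lin_sub_right (u : Fin p → ℝ) (x y : EuclideanSpace ℝ (Fin p)) :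
    lin u (x - y) = lin u x - lin u y := by
  simp [lin, mul_sub, Finset.sum_sub_distrib]

theorem lin_sampleMean (u : Fin p → ℝ) (x : Fin n → EuclideanSpace ℝ (Fin p)) :
    lin u (sampleMean x) = (n : ℝ)⁻¹ * ∑ l, lin u (x l) := by
  simp only [lin, sampleMean, PiLp.smul_apply, WithLp.ofLp_sum, Finset.sum_apply, smul_eq_mul]
  rw [Finset.sum_comm, Finset.mul_sum]
  refine Finset.sum_congr rfl fun i _ => ?_
  rw [Finset.mul_sum, Finset.mul_sum, Finset.mul_sum]
  exact Finset.sum_congr rfl fun j _ => by ring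

theorem dotProduct_sampleCov_mulVec (x : Fin n → EuclideanSpace ℝ (Fin p)) (u v : Fin p → ℝ) :
    u ⬝ᵥ sampleCov x *ᵥ v = (n : ℝ)⁻¹ * ∑ k, (lin u (x k) - (n : ℝ)⁻¹ * ∑ l, lin u (x l)) *
      (lin v (x k) - (n : ℝ)⁻¹ * ∑ l, lin v (x l)) := by
  simp_rw [← lin_sampleMean, ← lin_sub_right, lin, Finset.sum_mul_sum, dotProduct, Matrix.mulVec,
    dotProduct, sampleCov, Matrix.of_apply, Finset.mul_sum]
  conv_rhs => rw [Finset.sum_comm]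
  refine Finset.sum_congr rfl fun i _ => ?_
  conv_rhs => rw [Finset.sum_comm]
  refine Finset.sum_congr rfl fun j _ => ?_
  rw [Finset.sum_mul, Finset.mul_sum]
  exact Finset.sum_congr rfl fun k _ => by simp only [PiLp.sub_apply]; ring

/-- Centred values sum to zero, so centring the second factor is superfluous. This makes the
coefficient error linear in the raw residuals, with coefficients depending on the regressors alone.
-/
theorem sum_sub_mean_mul_sub_mean {n : ℕ} (f g : Fin n → ℝ) :
    ∑ k, (f k - (n : ℝ)⁻¹ * ∑ l, f l) * (g k - (n : ℝ)⁻¹ * ∑ l, g l) =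
      ∑ k, (f k - (n : ℝ)⁻¹ * ∑ l, f l) * g k := by
  rcases Nat.eq_zero_or_pos n with rfl | hn
  · simp
  have h : ∑ k, (f k - (n : ℝ)⁻¹ * ∑ l, f l) = 0 := by
    rw [Finset.sum_sub_distrib, Finset.sum_const, Finset.card_univ, Fintype.card_fin, nsmul_eq_mul,
      mul_inv_cancel_left₀ (by positivity), sub_self]
  simp_rw [mul_sub, Finset.sum_sub_distrib, ← Finset.sum_mul, h]
  simp

variable {Ω : Type*} [MeasurableSpace Ω] {P : Measure Ω} {S : Matrix (Fin p) (Fin p) ℝ}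
  {X : Fin n → Ω → EuclideanSpace ℝ (Fin p)}

theorem hasLaw_lin_comp (hS : S.PosSemidef)
    (hlaw : ∀ k, HasLaw (X k) (multivariateGaussian 0 S) P) (u : Fin p → ℝ) (k : Fin n) :
    HasLaw (fun ω => lin u (X k ω)) (gaussianReal 0 (u ⬝ᵥ S *ᵥ u).toNNReal) P :=
  (hasLaw_lin hS u).comp (hlaw k)

theorem iIndepFun_lin_comp (hind : iIndepFun X P) (u : Fin p → ℝ) :
    iIndepFun (fun k ω => lin u (X k ω)) P :=
  hind.comp (fun _ => lin u) fun _ => measurable_lin u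

/-- Concentration of a quadratic form of the sample covariance matrix. -/
theorem measureReal_quadratic_le (hS : S.PosDef)
    (hlaw : ∀ k, HasLaw (X k) (multivariateGaussian 0 S) P) (hind : iIndepFun X P) (hn : 0 < n)
    {u : Fin p → ℝ} {M δ : ℝ} (hM : 0 < M) (hu : u ⬝ᵥ S *ᵥ u ≤ M) (hδ : 0 < δ) (hδ1 : δ ≤ 1) :
    P.real {ω | M * δ < |u ⬝ᵥ sampleCov (fun k => X k ω) *ᵥ u - u ⬝ᵥ S *ᵥ u|} ≤
      4 * Real.exp (-(n * δ ^ 2 / 32)) := by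
  have : IsProbabilityMeasure P := hind.isProbabilityMeasure
  -- The concentration bound needs positive variance, which fails only for the zero vector.
  by_cases h0 : u = 0
  · subst h0
    have : {ω : Ω | M * δ < |(0 : Fin p → ℝ) ⬝ᵥ sampleCov (fun k => X k ω) *ᵥ 0 -
        (0 : Fin p → ℝ) ⬝ᵥ S *ᵥ 0|} = ∅ := by
      ext ω
      simpa using (mul_pos hM hδ).le
    rw [this]
    simp
    positivity
  have hpos : 0 < u ⬝ᵥ S *ᵥ u := by simpa using hS.dotProduct_mulVec_pos h0
  have h := measureReal_sampleVar_sub_gt_le (hasLaw_lin_comp hS.posSemidef hlaw u)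
    (iIndepFun_lin_comp hind u) (by simpa using hpos) hn hδ hδ1
  refine (measureReal_mono fun ω hω => ?_).trans h
  simp only [Set.mem_ofPred_eq, Real.coe_toNNReal _ hpos.le] at hω ⊢
  rw [dotProduct_sampleCov_mulVec] at hω
  simp_rw [sq]
  exact (mul_le_mul_of_nonneg_right hu hδ.le).trans_lt hω

/-- Concentration of the bilinear form of the sample covariance matrix. -/
theorem measureReal_bilinear_le (hS : S.PosDef)
    (hlaw : ∀ k, HasLaw (X k) (multivariateGaussian 0 S) P) (hind : iIndepFun X P) (hn : 0 < n)
    {u v : Fin p → ℝ} {M δ : ℝ} (hM : 0 < M) (hu : u ⬝ᵥ S *ᵥ u ≤ M) (hv : v ⬝ᵥ S *ᵥ v ≤ M)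
    (hδ : 0 < δ) (hδ1 : δ ≤ 1) :
    P.real {ω | 2 * M * δ < |u ⬝ᵥ sampleCov (fun k => X k ω) *ᵥ v - u ⬝ᵥ S *ᵥ v|} ≤
      8 * Real.exp (-(n * δ ^ 2 / 32)) := by
  have : IsProbabilityMeasure P := hind.isProbabilityMeasure
  have eadd : ∀ T : Matrix (Fin p) (Fin p) ℝ, T.IsSymm → (u + v) ⬝ᵥ T *ᵥ (u + v) =
      u ⬝ᵥ T *ᵥ u + 2 * (u ⬝ᵥ T *ᵥ v) + v ⬝ᵥ T *ᵥ v := fun T hT => by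
    rw [Matrix.mulVec_add, add_dotProduct, dotProduct_add, dotProduct_add,
      dotProduct_mulVec_comm hT v u]
    ring
  have esub : ∀ T : Matrix (Fin p) (Fin p) ℝ, T.IsSymm → (u - v) ⬝ᵥ T *ᵥ (u - v) =
      u ⬝ᵥ T *ᵥ u - 2 * (u ⬝ᵥ T *ᵥ v) + v ⬝ᵥ T *ᵥ v := fun T hT => by
    rw [Matrix.mulVec_sub, sub_dotProduct, dotProduct_sub, dotProduct_sub,
      dotProduct_mulVec_comm hT v u]
    ring
  have hSs := isSymm_of_posSemidef hS.posSemidef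
  have p1 : 0 ≤ (u + v) ⬝ᵥ S *ᵥ (u + v) := by
    simpa using hS.posSemidef.dotProduct_mulVec_nonneg (u + v)
  have p2 : 0 ≤ (u - v) ⬝ᵥ S *ᵥ (u - v) := by
    simpa using hS.posSemidef.dotProduct_mulVec_nonneg (u - v)
  have s1 := eadd S hSs
  have s2 := esub S hSs
  -- Polarisation. The forms at u ± v are nonnegative with sum at most 4 M, so each is at most 4 M;
  -- errors of 4 M δ in both give 2 M δ after division by four.
  have h1 := measureReal_quadratic_le hS hlaw hind hn (u := u + v) (M := 4 * M) (by positivity)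
    (by linarith) hδ hδ1
  have h2 := measureReal_quadratic_le hS hlaw hind hn (u := u - v) (M := 4 * M) (by positivity)
    (by linarith) hδ hδ1
  have hset : {ω | 2 * M * δ < |u ⬝ᵥ sampleCov (fun k => X k ω) *ᵥ v - u ⬝ᵥ S *ᵥ v|} ⊆
      {ω | 4 * M * δ < |(u + v) ⬝ᵥ sampleCov (fun k => X k ω) *ᵥ (u + v) -
        (u + v) ⬝ᵥ S *ᵥ (u + v)|} ∪
      {ω | 4 * M * δ < |(u - v) ⬝ᵥ sampleCov (fun k => X k ω) *ᵥ (u - v) -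
        (u - v) ⬝ᵥ S *ᵥ (u - v)|} := by
    intro ω hω
    by_contra hcon
    simp only [Set.mem_union, Set.mem_ofPred_eq, not_or, not_lt] at hcon hω
    obtain ⟨g1, g2⟩ := hcon
    have t1 := eadd _ (isSymm_sampleCov fun k => X k ω)
    have t2 := esub _ (isSymm_sampleCov fun k => X k ω)
    rw [abs_le] at g1 g2
    rcases lt_abs.1 hω with h | h <;> linarith
  have := (measureReal_mono hset).trans (measureReal_union_le (μ := P) _ _)
  linarith

end Sample

end DagCov

namespace DagCov

/-! ### Errors of regression coefficients, conditionally on the regressors -/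

section CoefficientError

open scoped NNReal

variable {p n : ℕ} {K : Finset (Fin p)}

/-- The vector with coordinates `y` in `K` and zero elsewhere. -/
noncomputable def embed (K : Finset (Fin p)) (y : K → ℝ) : EuclideanSpace ℝ (Fin p) :=
  WithLp.toLp 2 (extendZero K y)

theorem embed_coords_apply (x : EuclideanSpace ℝ (Fin p)) {j : Fin p} (hj : j ∈ K) :
    embed K (coords K x) j = x j := by
  simp [embed, extendZero, hj, coords]

theorem lin_embed_coords {w : Fin p → ℝ} (hw : ∀ j, j ∉ K → w j = 0)
    (x : EuclideanSpace ℝ (Fin p)) : lin w (embed K (coords K x)) = lin w x := by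
  refine Finset.sum_congr rfl fun j _ => ?_
  by_cases hj : j ∈ K
  · rw [embed_coords_apply x hj]
  · rw [hw j hj, zero_mul, zero_mul]

/-- The coefficients of the residuals involve only this block, so they are functions of the
regressors. That is what permits conditioning on X_K. -/
theorem principal_sampleCov_embed_coords (x : Fin n → EuclideanSpace ℝ (Fin p)) :
    principal (sampleCov fun k => embed K (coords K (x k))) K = principal (sampleCov x) K := by
  ext a b
  simp only [principal, Matrix.submatrix_apply, sampleCov, Matrix.of_apply, sampleMean,
    PiLp.smul_apply, WithLp.ofLp_sum, Finset.sum_apply, embed_coords_apply _ a.2,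
    embed_coords_apply _ b.2]

/-- The coefficients of the residuals in the error of the regression coefficient of the
variable `j`, as a function of the observations of the regressors. -/
noncomputable def errorCoef (K : Finset (Fin p)) (j : K) (y : Fin n → K → ℝ) : Fin n → ℝ :=
  fun k => (n : ℝ)⁻¹ * (lin (invCol (sampleCov fun k => embed K (y k)) K j) (embed K (y k)) -
    (n : ℝ)⁻¹ * ∑ l, lin (invCol (sampleCov fun k => embed K (y k)) K j) (embed K (y l)))

theorem errorCoef_coords (j : K) (x : Fin n → EuclideanSpace ℝ (Fin p)) (k : Fin n) :
    errorCoef K j (fun k => coords K (x k)) k =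
      (n : ℝ)⁻¹ * (lin (invCol (sampleCov x) K j) (x k) -
        (n : ℝ)⁻¹ * ∑ l, lin (invCol (sampleCov x) K j) (x l)) := by
  have h : invCol (sampleCov fun k => embed K (coords K (x k))) K j =
      invCol (sampleCov x) K j := by
    rw [invCol, invCol, principal_sampleCov_embed_coords]
  have hw : ∀ i, i ∉ K → invCol (sampleCov x) K j i = 0 :=
    fun i hi => extendZero_of_notMem _ hi
  simp only [errorCoef, h, lin_embed_coords hw]

theorem measurable_errorCoef (j : K) :
    Measurable (errorCoef (n := n) K j) := by
  have he : ∀ i k, Continuous fun y : Fin n → K → ℝ => embed K (y k) i := by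
    intro i k
    by_cases hi : i ∈ K
    · simp only [embed, extendZero, hi, dite_true]
      fun_prop
    · simp only [embed, extendZero, hi, dite_false]
      fun_prop
  have hT : Continuous fun y : Fin n → K → ℝ => principal (sampleCov fun k => embed K (y k)) K := by
    refine continuous_matrix fun a b => ?_
    simp only [principal, Matrix.submatrix_apply, sampleCov, Matrix.of_apply, sampleMean,
      PiLp.smul_apply, WithLp.ofLp_sum, Finset.sum_apply]
    fun_prop
  -- Matrix inversion is discontinuous at singular matrices; measurability comes from the formula
  -- det⁻¹ times adjugate, with 0 as the inverse of 0.
  have hinv : ∀ i, Measurable fun y : Fin n → K → ℝ =>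
      invCol (sampleCov fun k => embed K (y k)) K j i := by
    intro i
    by_cases hi : i ∈ K
    · simp only [invCol, extendZero, hi, dite_true, Matrix.inv_def, Ring.inverse_eq_inv',
        Matrix.smul_apply, smul_eq_mul]
      exact hT.matrix_det.measurable.inv.mul
        (hT.matrix_adjugate.matrix_elem ⟨i, hi⟩ j).measurable
    · simp only [invCol, extendZero, hi, dite_false]
      fun_prop
  have hlin : ∀ k, Measurable fun y : Fin n → K → ℝ =>
      lin (invCol (sampleCov fun k => embed K (y k)) K j) (embed K (y k)) := fun k =>
    Finset.measurable_sum _ fun i _ => (hinv i).mul (he i k).measurable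
  refine measurable_pi_lambda _ fun k => ?_
  unfold errorCoef
  exact ((hlin k).sub ((Finset.measurable_sum _ fun l _ => hlin l).const_mul _)).const_mul _

variable {Ω : Type*} [MeasurableSpace Ω] {P : Measure Ω} {S : Matrix (Fin p) (Fin p) ℝ}
  {X : Fin n → Ω → EuclideanSpace ℝ (Fin p)}

/-- The observations of the variables in `K` are independent of the residuals. -/
theorem indepFun_coords_lin (hS : S.PosSemidef)
    (hlaw : ∀ k, HasLaw (X k) (multivariateGaussian 0 S) P) (hind : iIndepFun X P)
    {a : Fin p → ℝ} (ha : ∀ k ∈ K, (S *ᵥ a) k = 0) :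
    IndepFun (fun ω k => coords K (X k ω)) (fun ω k => lin a (X k ω)) P := by
  have hX : HasGaussianLaw (fun ω k => X k ω) P :=
    hind.hasGaussianLaw fun k => (hlaw k).hasGaussianLaw
  have hG : HasGaussianLaw (fun ω => (fun q : Fin n × K => X q.1 ω q.2,
      fun k : Fin n => lin a (X k ω))) P := by
    refine hX.map_fun
      ((ContinuousLinearMap.pi fun q : Fin n × K =>
        (EuclideanSpace.proj (q.2 : Fin p) : EuclideanSpace ℝ (Fin p) →L[ℝ] ℝ).comp
          (ContinuousLinearMap.proj q.1)).prod
        (ContinuousLinearMap.pi fun k : Fin n =>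
          (∑ i, a i • (EuclideanSpace.proj i : EuclideanSpace ℝ (Fin p) →L[ℝ] ℝ)).comp
            (ContinuousLinearMap.proj k))) |>.congr ?_
    filter_upwards with ω
    ext <;> simp [lin]
  have h := hG.indepFun_of_covariance_eval (X := fun (q : Fin n × K) ω => X q.1 ω q.2)
    (Y := fun k ω => lin a (X k ω)) fun q k => by
      -- Within one observation the covariance vanishes by the normal equations; across
      -- observations, by independence.
      by_cases hqk : q.1 = k
      · rw [hqk]
        have := (hlaw k).covariance_fun_comp (f := fun x => x (q.2 : Fin p)) (g := lin a)
          (by fun_prop) (by fun_prop)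
        rw [this, ← lin_single' (q.2 : Fin p), covariance_lin hS]
        simpa using ha q.2 q.2.2
      · refine IndepFun.covariance_eq_zero ?_ ?_ ?_
        · exact (hind.indepFun hqk).comp (φ := fun x => x (q.2 : Fin p)) (ψ := lin a)
            (by fun_prop) (by fun_prop)
        · exact (hG.fst.eval q).memLp_two
        · exact (hG.snd.eval k).memLp_two
  exact h.comp (φ := fun (f : Fin n × K → ℝ) k j => f (k, j)) (ψ := id)
    (by fun_prop) measurable_id

/-- Tail bound for the error of a regression coefficient, on the event that the sample covariance
matrix of the regressors is not much smaller than the population one. -/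
theorem measureReal_resVec_sub_le (hS : S.PosDef)
    (hlaw : ∀ k, HasLaw (X k) (multivariateGaussian 0 S) P) (hind : iIndepFun X P) (hn : 0 < n)
    {i : Fin p} {r M t : ℝ} (hr : 0 < r)
    (hu : IsUnit (principal S K)) (hM : resVec S i K ⬝ᵥ S *ᵥ resVec S i K ≤ M) (j : K)
    (hK : ∀ w : Fin p → ℝ, (∀ k, k ∉ K → w k = 0) → r * w j ^ 2 ≤ w ⬝ᵥ S *ᵥ w) (ht : 0 ≤ t) :
    P.real {ω | (∀ w : Fin p → ℝ, (∀ k, k ∉ K → w k = 0) →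
        w ⬝ᵥ S *ᵥ w ≤ 2 * (w ⬝ᵥ sampleCov (fun k => X k ω) *ᵥ w)) ∧
      t ≤ |(resVec (sampleCov fun k => X k ω) i K - resVec S i K) j|} ≤
      2 * Real.exp (-(n * t ^ 2 * r / (4 * M))) := by
  have : IsProbabilityMeasure P := hind.isProbabilityMeasure
  have hSs := isSymm_of_posSemidef hS.posSemidef
  set a := resVec S i K with ha
  have ha0 : 0 ≤ a ⬝ᵥ S *ᵥ a := by simpa using hS.posSemidef.dotProduct_mulVec_nonneg a
  have hn' : (0 : ℝ) < n := by positivity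
  have h := measureReal_le_abs_sum_mul_le_of_indepFun (hasLaw_lin_comp hS.posSemidef hlaw a)
    (iIndepFun_lin_comp hind a)
    (W := fun ω k => coords K (X k ω))
    (aemeasurable_pi_lambda _ fun k => (measurable_coords K).comp_aemeasurable (hlaw k).aemeasurable)
    (indepFun_coords_lin hS.posSemidef hlaw hind
      fun k hk => mulVec_resVec_of_mem hSs hu hk)
    (measurable_errorCoef j) (s := M * (2 / (n * r))) (τ := t) ht
  have e : t ^ 2 / (2 * (M * (2 / (n * r)))) = n * t ^ 2 * r / (4 * M) := by
    field_simp
    norm_num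
  rw [e] at h
  refine (measureReal_mono fun ω hω => ?_).trans h
  obtain ⟨h1, h2⟩ := hω
  set T := sampleCov fun k => X k ω with hT
  have hTs : T.IsSymm := isSymm_sampleCov _
  have hTu : IsUnit (principal T K) := by
    refine (posDef_principal hTs fun w hw hw0 => ?_).isUnit
    have := hS.dotProduct_mulVec_pos hw0
    rw [star_trivial] at this
    linarith [h1 w hw]
  have hsupp : ∀ k, k ∉ K → invCol T K j k = 0 := fun k hk => extendZero_of_notMem _ hk
  have hc : ∀ k, errorCoef K j (fun k => coords K (X k ω)) k =
      (n : ℝ)⁻¹ * (lin (invCol T K j) (X k ω) - (n : ℝ)⁻¹ * ∑ l, lin (invCol T K j) (X l ω)) :=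
    errorCoef_coords j fun k => X k ω
  have hjj : invCol T K j ⬝ᵥ T *ᵥ invCol T K j = invCol T K j j :=
    dotProduct_mulVec_invCol hTu hsupp j
  -- Up to the factor 1/n², the sum of squares is n times the sample variance of the functional
  -- `invCol T K j`, whose quadratic form is the diagonal entry (T_KK⁻¹)_jj.
  have hsq : ∑ k, errorCoef K j (fun k => coords K (X k ω)) k ^ 2 = (n : ℝ)⁻¹ * invCol T K j j := by
    rw [← hjj, hT, dotProduct_sampleCov_mulVec, Finset.mul_sum, Finset.mul_sum]
    refine Finset.sum_congr rfl fun k _ => ?_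
    rw [hc]
    ring
  -- For w = `invCol T K j`: r w_j² ≤ wᵀ S w ≤ 2 wᵀ T w = 2 w_j.
  have hle : invCol T K j j ≤ 2 / r := by
    have h3 := (hK _ hsupp).trans (h1 _ hsupp)
    rw [hjj] at h3
    rw [le_div_iff₀ hr]
    by_contra! hcon
    have hpos : 0 < invCol T K j j := by
      by_contra! hneg
      nlinarith
    nlinarith
  refine ⟨?_, ?_⟩
  · rw [hsq, Real.coe_toNNReal _ ha0]
    refine mul_le_mul hM ?_ ?_ (ha0.trans hM)
    · rw [mul_comm (n : ℝ) r, ← div_div, div_eq_inv_mul _ (n : ℝ)]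
      exact mul_le_mul_of_nonneg_left hle (by positivity)
    · rw [← hsq]
      positivity
  · rw [resVec_sub_resVec_apply hTs hTu, abs_neg, hT, dotProduct_sampleCov_mulVec,
      sum_sub_mean_mul_sub_mean, Finset.mul_sum] at h2
    refine h2.trans_eq ?_
    congr 1
    refine Finset.sum_congr rfl fun k _ => ?_
    rw [hc, mul_assoc]

end CoefficientError

end DagCov

namespace DagCov

/-! ### Uniform error bounds for the regressions and the estimator -/

section Estimation

variable {p n : ℕ} {K : Finset (Fin p)} {Ω : Type*} [MeasurableSpace Ω] {P : Measure Ω}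
  {S : Matrix (Fin p) (Fin p) ℝ} {X : Fin n → Ω → EuclideanSpace ℝ (Fin p)}

/-- The main term contributes M t. The correction is a sum of |K| products of size 2 M t², and |K| 2
t ≤ 1/2 reduces it to M t / 2, so no factor |K| survives. -/
theorem abs_residVar_sub_le {T : Matrix (Fin p) (Fin p) ℝ} (hS : S.IsSymm) (hT : T.IsSymm)
    {i : Fin p} {M t : ℝ} (hSu : IsUnit (principal S K)) (hTu : IsUnit (principal T K))
    (ht : 0 ≤ t) (hK : K.card * (2 * t) ≤ 1 / 2) (hM : 0 ≤ M)
    (h1 : |resVec S i K ⬝ᵥ T *ᵥ resVec S i K - resVec S i K ⬝ᵥ S *ᵥ resVec S i K| ≤ M * t)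
    (h2 : ∀ k ∈ K, |(T *ᵥ resVec S i K) k| ≤ 2 * M * t)
    (h3 : ∀ k ∈ K, |(resVec T i K - resVec S i K) k| ≤ t) :
    |residVar T i K - residVar S i K| ≤ 2 * M * t := by
  rw [residVar_eq hT hTu, residVar_eq hS hSu, resVec_dotProduct_mulVec_eq (S := S) hT hTu,
    add_sub_right_comm]
  refine (abs_add_le _ _).trans ?_
  have h4 : |∑ k ∈ K, (resVec T i K - resVec S i K) k * (T *ᵥ resVec S i K) k| ≤
      K.card * (t * (2 * M * t)) := by
    refine (Finset.abs_sum_le_sum_abs _ _).trans ?_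
    rw [← nsmul_eq_mul]
    refine Finset.sum_le_card_nsmul _ _ _ fun k hk => ?_
    rw [abs_mul]
    exact mul_le_mul (h3 k hk) (h2 k hk) (abs_nonneg _) ht
  have h5 : K.card * (t * (2 * M * t)) ≤ 1 / 2 * (M * t) := by
    have := mul_le_mul_of_nonneg_right hK (mul_nonneg hM ht)
    linarith
  have := mul_nonneg hM ht
  linarith

/-- Uniform control of the regression of variable `i` on the variables in `K`. -/
theorem measureReal_regression_error_le (hS : S.PosDef)
    (hlaw : ∀ k, HasLaw (X k) (multivariateGaussian 0 S) P) (hind : iIndepFun X P) (hn : 0 < n)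
    {i : Fin p} {r M t c : ℝ} (hr : 0 < r) (hM0 : 0 < M)
    (hpd : (principal S K).PosDef) (hM : resVec S i K ⬝ᵥ S *ᵥ resVec S i K ≤ M)
    (hMk : ∀ k, S k k ≤ M)
    (hK : ∀ j ∈ K, ∀ w : Fin p → ℝ, (∀ k, k ∉ K → w k = 0) → r * w j ^ 2 ≤ w ⬝ᵥ S *ᵥ w)
    (ht : 0 < t) (ht1 : t ≤ 1) (hKt : K.card * (2 * t) ≤ 1 / 2)
    (hc1 : c ≤ 1 / 32) (hc2 : c ≤ r / (4 * M)) :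
    P.real {ω | ¬ ((∀ j, |(resVec (sampleCov fun k => X k ω) i K - resVec S i K) j| ≤ t) ∧
      |residVar (sampleCov fun k => X k ω) i K - residVar S i K| ≤ 2 * M * t)} ≤
      18 * (p + 1) ^ 2 * Real.exp (-(c * (n * t ^ 2))) := by
  have : IsProbabilityMeasure P := hind.isProbabilityMeasure
  have hSs := isSymm_of_posSemidef hS.posSemidef
  have hu := hpd.isUnit
  obtain ⟨b, hb, hbspan⟩ := exists_orthonormal_basis hpd
  set E := Real.exp (-(c * (n * t ^ 2))) with hE
  have hE1 : Real.exp (-(n * t ^ 2 / 32)) ≤ E := by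
    refine Real.exp_le_exp.2 (neg_le_neg ?_)
    have := mul_le_mul_of_nonneg_right hc1 (by positivity : (0 : ℝ) ≤ n * t ^ 2)
    linarith
  have hE2 : Real.exp (-(n * t ^ 2 * r / (4 * M))) ≤ E := by
    refine Real.exp_le_exp.2 (neg_le_neg ?_)
    have := mul_le_mul_of_nonneg_right hc2 (by positivity : (0 : ℝ) ≤ n * t ^ 2)
    refine this.trans_eq ?_
    ring
  set a := resVec S i K with ha
  let T : Ω → Matrix (Fin p) (Fin p) ℝ := fun ω => sampleCov fun k => X k ω
  -- Bad events: `F1` breaks the comparison of the forms on `K`; `F2` and `F3` spoil the two terms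
  -- of the residual variance; `F4` is a large coefficient error while the comparison holds.
  let F1 : K × K → Set Ω := fun q =>
    {ω | 2 * 1 * t < |b q.1 ⬝ᵥ T ω *ᵥ b q.2 - b q.1 ⬝ᵥ S *ᵥ b q.2|}
  let F2 : K → Set Ω := fun k =>
    {ω | 2 * M * t < |Pi.single (k : Fin p) 1 ⬝ᵥ T ω *ᵥ a - Pi.single (k : Fin p) 1 ⬝ᵥ S *ᵥ a|}
  let F3 : Set Ω := {ω | M * t < |a ⬝ᵥ T ω *ᵥ a - a ⬝ᵥ S *ᵥ a|}
  let F4 : K → Set Ω := fun j =>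
    {ω | (∀ w : Fin p → ℝ, (∀ k, k ∉ K → w k = 0) → w ⬝ᵥ S *ᵥ w ≤ 2 * (w ⬝ᵥ T ω *ᵥ w)) ∧
      t ≤ |(resVec (T ω) i K - a) j|}
  have p1 : P.real (⋃ q, F1 q) ≤ K.card ^ 2 * (8 * E) := by
    refine (measureReal_iUnion_fintype_le _).trans ?_
    refine (Finset.sum_le_card_nsmul _ _ (8 * E) fun q _ => ?_).trans_eq ?_
    · exact (measureReal_bilinear_le hS hlaw hind hn one_pos (by simp [hb]) (by simp [hb])
        ht ht1).trans (by linarith)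
    · simp [sq]
  have p2 : P.real (⋃ k, F2 k) ≤ K.card * (8 * E) := by
    refine (measureReal_iUnion_fintype_le _).trans ?_
    refine (Finset.sum_le_card_nsmul _ _ (8 * E) fun k _ => ?_).trans_eq ?_
    · exact (measureReal_bilinear_le hS hlaw hind hn hM0 (by simpa using hMk k) hM
        ht ht1).trans (by linarith)
    · simp
  have p3 : P.real F3 ≤ 4 * E :=
    (measureReal_quadratic_le hS hlaw hind hn hM0 hM ht ht1).trans (by linarith)
  have p4 : P.real (⋃ j, F4 j) ≤ K.card * (2 * E) := by
    refine (measureReal_iUnion_fintype_le _).trans ?_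
    refine (Finset.sum_le_card_nsmul _ _ (2 * E) fun j _ => ?_).trans_eq ?_
    · exact (measureReal_resVec_sub_le hS hlaw hind hn hr hu hM j (hK j j.2)
        ht.le).trans (by linarith)
    · simp
  have hsub : {ω | ¬ ((∀ j, |(resVec (T ω) i K - a) j| ≤ t) ∧
      |residVar (T ω) i K - residVar S i K| ≤ 2 * M * t)} ⊆
      (⋃ q, F1 q) ∪ (⋃ k, F2 k) ∪ F3 ∪ ⋃ j, F4 j := by
    intro ω hω
    by_contra hcon
    simp only [Set.mem_union, Set.mem_iUnion, not_or, not_exists] at hcon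
    obtain ⟨⟨⟨g1, g2⟩, g3⟩, g4⟩ := hcon
    refine hω ?_
    have hTs : (T ω).IsSymm := isSymm_sampleCov _
    have hcmp : ∀ w : Fin p → ℝ, (∀ k, k ∉ K → w k = 0) →
        w ⬝ᵥ S *ᵥ w ≤ 2 * (w ⬝ᵥ T ω *ᵥ w) := by
      intro w hw
      obtain ⟨d, hd⟩ := hbspan w hw
      refine dotProduct_mulVec_le_two_mul hb (η := 2 * t) (fun j l => ?_) hKt hd
      have : ¬ 2 * 1 * t < |b j ⬝ᵥ T ω *ᵥ b l - b j ⬝ᵥ S *ᵥ b l| := g1 (j, l)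
      rwa [not_lt, mul_one] at this
    have hTu : IsUnit (principal (T ω) K) := by
      refine (posDef_principal hTs fun w hw hw0 => ?_).isUnit
      have := hS.dotProduct_mulVec_pos hw0
      rw [star_trivial] at this
      linarith [hcmp w hw]
    have hd : ∀ j, |(resVec (T ω) i K - a) j| ≤ t := by
      intro j
      by_cases hj : j ∈ K
      · by_contra! hlt
        exact g4 ⟨j, hj⟩ ⟨hcmp, hlt.le⟩
      · rw [resVec_sub_resVec_of_notMem hj, abs_zero]
        exact ht.le
    refine ⟨hd, abs_residVar_sub_le hSs hTs hu hTu ht.le hKt hM0.le (not_lt.1 g3)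
      (fun k hk => ?_) fun k _ => hd k⟩
    have : ¬ 2 * M * t < |Pi.single k 1 ⬝ᵥ T ω *ᵥ a - Pi.single k 1 ⬝ᵥ S *ᵥ a| := g2 ⟨k, hk⟩
    simpa [mulVec_resVec_of_mem hSs hu hk, ha] using this
  have hq : (K.card : ℝ) ≤ p := by
    have := K.card_le_univ
    rw [Fintype.card_fin] at this
    exact_mod_cast this
  have hE0 : 0 < E := Real.exp_pos _
  have u1 := measureReal_union_le (μ := P) ((⋃ q, F1 q) ∪ (⋃ k, F2 k) ∪ F3) (⋃ j, F4 j)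
  have u2 := measureReal_union_le (μ := P) ((⋃ q, F1 q) ∪ (⋃ k, F2 k)) F3
  have u3 := measureReal_union_le (μ := P) (⋃ q, F1 q) (⋃ k, F2 k)
  refine (measureReal_mono hsub).trans ?_
  have : P.real ((⋃ q, F1 q) ∪ (⋃ k, F2 k) ∪ F3 ∪ ⋃ j, F4 j) ≤
      (8 * (K.card : ℝ) ^ 2 + 10 * K.card + 4) * E := by linarith
  refine this.trans (mul_le_mul_of_nonneg_right ?_ hE0.le)
  -- The union bound gives 8 |K|² + 10 |K| + 4 with |K| ≤ p, which is below 18 (p + 1)².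
  nlinarith [(Nat.cast_nonneg K.card : (0 : ℝ) ≤ _)]

theorem concentration_apply {G : Digraph (Fin p)} (h : ∀ i, residVar S i (pa G i) ≠ 0)
    (j k : Fin p) : concentration S G j k =
      ∑ i, regMatrix S G i j * regMatrix S G i k / residVar S i (pa G i) := by
  have hinv : (residCov S G)⁻¹ = Matrix.diagonal fun i => (residVar S i (pa G i))⁻¹ := by
    refine Matrix.inv_eq_right_inv ?_
    rw [residCov, Matrix.diagonal_mul_diagonal]
    simp [h]
  rw [concentration, hinv, Matrix.mul_apply]
  refine Finset.sum_congr rfl fun i _ => ?_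
  rw [Matrix.mul_diagonal, Matrix.transpose_apply]
  ring

theorem abs_mul_div_sub_mul_div_le {x y x' y' D D' L r t η : ℝ} (hr : 0 < r) (ht1 : t ≤ 1)
    (hL : 0 ≤ L) (hx : |x| ≤ L) (hy : |y| ≤ L) (hxx : |x' - x| ≤ t) (hyy : |y' - y| ≤ t)
    (hD : r ≤ D) (hDD : |D' - D| ≤ η) (hη : η ≤ r / 2) :
    |x' * y' / D' - x * y / D| ≤ (L + 1) ^ 2 * (2 * η / r ^ 2) + (2 * L + 1) * t / r := by
  have ht : 0 ≤ t := (abs_nonneg _).trans hxx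
  have hη0 : 0 ≤ η := (abs_nonneg _).trans hDD
  have hD0 : 0 < D := hr.trans_le hD
  have hD' : r / 2 ≤ D' := by linarith [(abs_le.1 hDD).1]
  have hD0' : 0 < D' := by linarith
  have hx' : |x'| ≤ L + 1 := by
    have := abs_add_le (x' - x) x
    rw [sub_add_cancel] at this
    linarith
  have hy' : |y'| ≤ L + 1 := by
    have := abs_add_le (y' - y) y
    rw [sub_add_cancel] at this
    linarith
  have e : x' * y' / D' - x * y / D =
      x' * y' * ((D - D') / (D * D')) + ((x' - x) * y' + x * (y' - y)) / D := by
    field_simp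
    ring
  rw [e]
  refine (abs_add_le _ _).trans (add_le_add ?_ ?_)
  · rw [abs_mul, abs_mul, sq, abs_div, abs_sub_comm, abs_of_pos (mul_pos hD0 hD0')]
    refine mul_le_mul (mul_le_mul hx' hy' (abs_nonneg _) (by linarith)) ?_ (by positivity)
      (by positivity)
    have : 2 * η / r ^ 2 = η / (r * (r / 2)) := by field_simp
    rw [this]
    exact div_le_div₀ hη0 hDD (by positivity) (mul_le_mul hD hD' (by positivity) hD0.le)
  · rw [abs_div, abs_of_pos hD0]
    refine div_le_div₀ (by positivity) ?_ hr hD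
    refine (abs_add_le _ _).trans ?_
    rw [abs_mul, abs_mul]
    have h1 := mul_le_mul hxx hy' (abs_nonneg _) ht
    have h2 := mul_le_mul hx hyy (abs_nonneg _) hL
    linarith

/-- The entries of the concentration matrix depend continuously on the regressions. -/
theorem abs_concentration_sub_le {T : Matrix (Fin p) (Fin p) ℝ} {G : Digraph (Fin p)}
    (hG : IsDAG G) {q : ℕ} (hq : ∀ i, (adjSet G i).card ≤ q) {L M r t : ℝ} (hr : 0 < r)
    (ht : 0 ≤ t) (ht1 : t ≤ 1) (hM : 0 ≤ M) (hL : 0 ≤ L)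
    (hA : ∀ i j, |resVec S i (pa G i) j| ≤ L)
    (hD : ∀ i, r ≤ residVar S i (pa G i)) (hMt : 2 * M * t ≤ r / 2)
    (hAA : ∀ i j, |(resVec T i (pa G i) - resVec S i (pa G i)) j| ≤ t)
    (hDD : ∀ i, |residVar T i (pa G i) - residVar S i (pa G i)| ≤ 2 * M * t) (j k : Fin p) :
    |concentration T G j k - concentration S G j k| ≤
      (q + 1) * (((L + 1) ^ 2 * (4 * M / r ^ 2) + (2 * L + 1) / r) * t) := by
  have hD' : ∀ i, 0 < residVar T i (pa G i) := fun i => by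
    linarith [(abs_le.1 (hDD i)).1, hD i]
  rw [concentration_apply fun i => (hD' i).ne',
    concentration_apply fun i => (hr.trans_le (hD i)).ne',
    ← Finset.sum_sub_distrib]
  -- Column j of A is supported on j and its children, so sparsity bounds the number of summands
  -- even though p may be far larger.
  have hsupp : ∀ i, i ∉ insert j (adjSet G j) → ∀ R : Matrix (Fin p) (Fin p) ℝ,
      regMatrix R G i j = 0 := by
    intro i hi R
    rw [Finset.mem_insert, not_or] at hi
    rw [regMatrix_apply R (hG.notMem_pa i)]
    exact resVec_of_notMem (fun h => hi.2 (hG.mem_adjSet_of_mem_pa h)) (Ne.symm hi.1)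
  rw [← Finset.sum_subset (Finset.subset_univ (insert j (adjSet G j))) fun i _ hi => by
    rw [hsupp i hi, hsupp i hi]; simp]
  refine (Finset.abs_sum_le_sum_abs _ _).trans ?_
  refine (Finset.sum_le_card_nsmul _ _
    (((L + 1) ^ 2 * (4 * M / r ^ 2) + (2 * L + 1) / r) * t) fun i _ => ?_).trans ?_
  · have hi := hG.notMem_pa i
    rw [regMatrix_apply T hi, regMatrix_apply T hi, regMatrix_apply S hi, regMatrix_apply S hi]
    refine (abs_mul_div_sub_mul_div_le hr ht1 hL (hA i j) (hA i k) (hAA i j) (hAA i k) (hD i)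
      (hDD i) hMt).trans_eq ?_
    ring
  · rw [nsmul_eq_mul]
    refine mul_le_mul_of_nonneg_right ?_ (by positivity)
    have := (Finset.card_insert_le j (adjSet G j)).trans (Nat.add_le_add_right (hq j) 1)
    exact_mod_cast this

/-- A finite-sample bound for the entrywise error of the DAG-based estimator. -/
theorem measureReal_concentrationEst_error_le (hS : S.PosSemidef)
    (hlaw : ∀ k, HasLaw (X k) (multivariateGaussian 0 S) P) (hind : iIndepFun X P) (hn : 0 < n)
    {G : Digraph (Fin p)} (hG : IsDAG G) (hMk : IsMarkov (multivariateGaussian 0 S) G)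
    {q : ℕ} (hq : ∀ i, (adjSet G i).card ≤ q) {r M t c γ : ℝ} (hr : 0 < r) (hM : 0 < M)
    (hF : CondVarBound (multivariateGaussian 0 S) G r) (hSM : ∀ i, S i i ≤ M)
    (ht : 0 < t) (ht1 : t ≤ 1) (hqt : q * (2 * t) ≤ 1 / 2) (hMt : 2 * M * t ≤ r / 2)
    (hc1 : c ≤ 1 / 32) (hc2 : c ≤ r / (4 * M)) (hγ : 0 ≤ γ)
    (hγt : (q + 1) * ((((1 + M / r) + 1) ^ 2 * (4 * M / r ^ 2) + (2 * (1 + M / r) + 1) / r) * t) ≤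
      γ) :
    P.real {ω | γ < ⨆ ij : Fin p × Fin p,
        |concentrationEst G (fun k => X k ω) ij.1 ij.2 - S⁻¹ ij.1 ij.2|} ≤
      18 * (p + 1) ^ 3 * Real.exp (-(c * (n * t ^ 2))) := by
  have : IsProbabilityMeasure P := hind.isProbabilityMeasure
  obtain ⟨hunit, hconc⟩ := isUnit_and_concentration_eq_inv hS hr hG hMk hF
  have hpd : S.PosDef := hS.posDef_iff_isUnit.2 hunit
  have hSs := isSymm_of_posSemidef hS
  let F : Fin p → Set Ω := fun i =>
    {ω | ¬ ((∀ j, |(resVec (sampleCov fun k => X k ω) i (pa G i) - resVec S i (pa G i)) j| ≤ t) ∧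
      |residVar (sampleCov fun k => X k ω) i (pa G i) - residVar S i (pa G i)| ≤ 2 * M * t)}
  have hFi : ∀ i, P.real (F i) ≤ 18 * (p + 1) ^ 2 * Real.exp (-(c * (n * t ^ 2))) := by
    intro i
    refine measureReal_regression_error_le hpd hlaw hind hn hr hM (hF.posDef_principal hS hr i) ?_
      hSM (fun j hj w hw => hF.mul_sq_le hS hj hw) ht ht1 ?_ hc1 hc2
    · rw [← residVar_eq hSs (hF.posDef_principal hS hr i).isUnit]
      exact (hF.residVar_le hS hr i).trans (hSM i)
    · refine le_trans (mul_le_mul_of_nonneg_right ?_ (by positivity)) hqt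
      exact_mod_cast (Finset.card_le_card (hG.pa_subset_adjSet i)).trans (hq i)
  have hsub : {ω | γ < ⨆ ij : Fin p × Fin p,
      |concentrationEst G (fun k => X k ω) ij.1 ij.2 - S⁻¹ ij.1 ij.2|} ⊆ ⋃ i, F i := by
    intro ω hω
    by_contra hcon
    simp only [F, Set.mem_iUnion, not_exists, Set.mem_ofPred_eq, not_not] at hcon
    refine (not_le.2 hω) (Real.iSup_le (fun ij => ?_) hγ)
    rw [← hconc]
    refine (abs_concentration_sub_le hG hq hr ht.le ht1 hM.le (by positivity) (fun i j => ?_)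
      (fun i => hF.le_residVar hS hr i) hMt (fun i => (hcon i).1) (fun i => (hcon i).2)
      ij.1 ij.2).trans hγt
    refine (hF.abs_resVec_le hS hr (hG.notMem_pa i) j).trans ?_
    gcongr
    exact hSM i
  refine (measureReal_mono hsub).trans ((measureReal_iUnion_fintype_le _).trans ?_)
  refine (Finset.sum_le_card_nsmul _ _ _ fun i _ => hFi i).trans ?_
  rw [Finset.card_univ, Fintype.card_fin, nsmul_eq_mul]
  have : (0 : ℝ) ≤ 18 * (p + 1) ^ 2 * Real.exp (-(c * (n * t ^ 2))) := by positivity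
  nlinarith

end Estimation

end DagCov

namespace DagCov

/-! ### Asymptotic rates -/

section Asymptotics

theorem IsMarkov.of_equivalent {p : ℕ} {P : Measure (EuclideanSpace ℝ (Fin p))} [IsFiniteMeasure P]
    {G H : Digraph (Fin p)} (hH : IsMarkov P H) (hGH : Equivalent G H) : IsMarkov P G :=
  fun A B S hAB hAS hBS h => hH A B S hAB hAS hBS ((hGH A B S hAB hAS hBS).1 h)

theorem tendsto_natCast_rpow_atTop {b : ℝ} (hb : 0 < b) :
    Tendsto (fun n : ℕ => (n : ℝ) ^ b) atTop atTop :=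
  (tendsto_rpow_atTop hb).comp tendsto_natCast_atTop_atTop

theorem tendsto_natCast_rpow_neg {b : ℝ} (hb : b < 0) :
    Tendsto (fun n : ℕ => (n : ℝ) ^ b) atTop (𝓝 0) := by
  have := (tendsto_rpow_neg_atTop (neg_pos.2 hb)).comp (tendsto_natCast_atTop_atTop (R := ℝ))
  simp only [neg_neg] at this
  exact this

theorem tendsto_mul_rpow_zero {q : ℕ → ℝ} {α β : ℝ}
    (hq : q =O[atTop] fun n : ℕ => (n : ℝ) ^ α) (h : α + β < 0) :
    Tendsto (fun n : ℕ => q n * (n : ℝ) ^ β) atTop (𝓝 0) := by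
  have h1 := hq.mul (isBigO_refl (fun n : ℕ => (n : ℝ) ^ β) atTop)
  refine (h1.congr' .rfl ?_).trans_tendsto (tendsto_natCast_rpow_neg h)
  filter_upwards [eventually_gt_atTop 0] with n hn
  rw [← Real.rpow_add (by positivity)]

theorem tendsto_pow_mul_exp_neg_rpow_zero {p : ℕ → ℕ} {a b c : ℝ} (ha : 0 ≤ a) (hb : 0 < b)
    (hc : 0 < c) (hp : (fun n => (p n : ℝ)) =O[atTop] fun n : ℕ => (n : ℝ) ^ a) :
    Tendsto (fun n : ℕ => 18 * ((p n : ℝ) + 1) ^ 3 * Real.exp (-(c * (n : ℝ) ^ b))) atTop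
      (𝓝 0) := by
  have h1 : (fun _ : ℕ => (1 : ℝ)) =O[atTop] fun n : ℕ => (n : ℝ) ^ a := by
    refine IsBigO.of_bound 1 ?_
    filter_upwards [eventually_ge_atTop 1] with n hn
    have : (1 : ℝ) ≤ (n : ℝ) ^ a := Real.one_le_rpow (by exact_mod_cast hn) ha
    rw [norm_one, one_mul]
    exact this.trans (le_abs_self _)
  have h2 := ((((hp.add h1).pow 3).const_mul_left 18).mul
    (isBigO_refl (fun n : ℕ => Real.exp (-(c * (n : ℝ) ^ b))) atTop))
  -- The polynomial factor n^(3a) is rewritten as a power of n^b, so that the exponential decay in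
  -- n^b applies.
  have h3 : Tendsto (fun n : ℕ => ((n : ℝ) ^ b) ^ (a * 3 / b) * Real.exp (-c * (n : ℝ) ^ b)) atTop
      (𝓝 0) :=
    (tendsto_rpow_mul_exp_neg_mul_atTop_nhds_zero _ c hc).comp (tendsto_natCast_rpow_atTop hb)
  refine (h2.congr' .rfl ?_).trans_tendsto h3
  filter_upwards with n
  rw [← Real.rpow_natCast, ← Real.rpow_mul (by positivity), ← Real.rpow_mul (by positivity),
    neg_mul]
  congr 2
  push_cast
  field_simp

end Asymptotics

end DagCov

/-! ### Consistency of the estimator -/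

theorem mainTheorem2
    -- dimensions, covariance matrices and true DAGs
    (p : ℕ → ℕ)
    (Sig : ∀ n, Matrix (Fin (p n)) (Fin (p n)) ℝ)
    (hSig : ∀ n, (Sig n).PosSemidef)
    (G₀ : ∀ n, Digraph (Fin (p n)))
    -- the data are i.i.d. normal; the distribution is Markov and faithful to the true DAG
    {Ω : ℕ → Type*} [∀ n, MeasurableSpace (Ω n)]
    (Pr : ∀ n, Measure (Ω n)) [∀ n, IsProbabilityMeasure (Pr n)]
    (X : ∀ n, Fin n → Ω n → EuclideanSpace ℝ (Fin (p n)))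
    (hlaw : ∀ n k, HasLaw (X n k) (multivariateGaussian 0 (Sig n)) (Pr n))
    (hindep : ∀ n, iIndepFun (X n) (Pr n))
    (hG₀ : ∀ n, DagCov.IsDAG (G₀ n))
    (hMarkov : ∀ n, DagCov.IsMarkov (multivariateGaussian 0 (Sig n)) (G₀ n))
    (hfaith : ∀ n, DagCov.IsFaithful (multivariateGaussian 0 (Sig n)) (G₀ n))
    -- bounded variances
    (σ : ℝ)
    (hB : ∀ n i, Var[fun x : EuclideanSpace ℝ (Fin (p n)) => x i;
      multivariateGaussian 0 (Sig n)] ≤ σ ^ 2)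
    -- polynomially growing dimension
    (a : ℝ) (ha : 0 ≤ a)
    (hC : (fun n => (p n : ℝ)) =O[atTop] fun n : ℕ => (n : ℝ) ^ a)
    -- sparsity of the true DAG
    (b : ℝ) (hb0 : 0 < b) (hb : b ≤ 1 / 2)
    (hD : (fun n => (DagCov.maxAdj (G₀ n) : ℝ)) =O[atTop] fun n : ℕ => (n : ℝ) ^ (1 / 2 - b))
    -- conditional variances bounded below, for every DAG in the true equivalence class
    (r : ℝ) (hr : 0 < r)
    (hF : ∀ n, ∀ H : Digraph (Fin (p n)), DagCov.IsDAG H → DagCov.Equivalent H (G₀ n) →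
      DagCov.CondVarBound (multivariateGaussian 0 (Sig n)) H r)
    -- any choice of DAGs in the true equivalence classes
    (G : ∀ n, Digraph (Fin (p n)))
    (hG : ∀ n, DagCov.IsDAG (G n))
    (hGequiv : ∀ n, DagCov.Equivalent (G n) (G₀ n)) :
    (∀ n, IsUnit (Sig n)) ∧
    ∀ γ : ℝ, 0 < γ →
      Tendsto
        (fun n => Pr n {ω | γ < ⨆ ij : Fin (p n) × Fin (p n),
          |DagCov.concentrationEst (G n) (fun k => X n k ω) ij.1 ij.2 - (Sig n)⁻¹ ij.1 ij.2|})
        atTop (𝓝 0) := by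
  have hGM := fun n => (hMarkov n).of_equivalent (hGequiv n)
  have hGF := fun n => hF n (G n) (hG n) (hGequiv n)
  refine ⟨fun n => (DagCov.isUnit_and_concentration_eq_inv (hSig n) hr (hG n) (hGM n) (hGF n)).1,
    fun γ hγ => ?_⟩
  -- The added 1 keeps `M` positive even when σ = 0.
  set M : ℝ := σ ^ 2 + 1 with hM
  have hM0 : 0 < M := by positivity
  have hSM : ∀ n i, Sig n i i ≤ M := fun n i => by
    have := hB n i
    rw [variance_eval_multivariateGaussian (hSig n)] at this
    linarith
  set c : ℝ := min (1 / 32) (r / (4 * M)) with hc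
  have hc0 : 0 < c := by positivity
  set C : ℝ := ((1 + M / r) + 1) ^ 2 * (4 * M / r ^ 2) + (2 * (1 + M / r) + 1) / r with hCdef
  -- This exponent gives q t = O(n^(-b/2)) → 0 and n t² = n^b → ∞ simultaneously.
  set t : ℕ → ℝ := fun n => (n : ℝ) ^ (-(1 / 2) + b / 2) with ht
  have htlim : Tendsto t atTop (𝓝 0) := DagCov.tendsto_natCast_rpow_neg (by linarith)
  have hqlim : Tendsto (fun n => (DagCov.maxAdj (G₀ n) : ℝ) * t n) atTop (𝓝 0) :=
    DagCov.tendsto_mul_rpow_zero hD (by linarith)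
  have hlim1 : Tendsto (fun n => (DagCov.maxAdj (G₀ n) : ℝ) * (2 * t n)) atTop (𝓝 0) := by
    have := hqlim.const_mul 2
    rw [mul_zero] at this
    exact this.congr fun n => by ring
  have hlim2 : Tendsto (fun n => 2 * M * t n) atTop (𝓝 0) := by
    simpa using htlim.const_mul (2 * M)
  have hlim3 : Tendsto (fun n => ((DagCov.maxAdj (G₀ n) : ℝ) + 1) * (C * t n)) atTop (𝓝 0) := by
    have := (hqlim.add htlim).const_mul C
    rw [add_zero, mul_zero] at this
    exact this.congr fun n => by ring
  have hbound := DagCov.tendsto_pow_mul_exp_neg_rpow_zero ha hb0 hc0 hC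
  have hbound' := ENNReal.tendsto_ofReal hbound
  rw [ENNReal.ofReal_zero] at hbound'
  refine tendsto_of_tendsto_of_tendsto_of_le_of_le' tendsto_const_nhds hbound'
    (.of_forall fun _ => zero_le) ?_
  filter_upwards [eventually_gt_atTop 0, htlim.eventually_le_const one_pos,
    hlim1.eventually_le_const one_half_pos, hlim2.eventually_le_const (half_pos hr),
    hlim3.eventually_le_const hγ] with n hn h1 h2 h3 h4
  have hn' : (0 : ℝ) < n := by exact_mod_cast hn
  have h := DagCov.measureReal_concentrationEst_error_le (hSig n) (hlaw n) (hindep n) hn (hG n)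
    (hGM n) ((hG₀ n).card_adjSet_le_of_equivalent (hGequiv n)) hr hM0 (hGF n) (hSM n)
    (Real.rpow_pos_of_pos hn' _) h1 h2 h3 (min_le_left _ _) (min_le_right _ _) hγ.le h4
  have e : (n : ℝ) * t n ^ 2 = (n : ℝ) ^ b := by
    rw [ht, ← Real.rpow_natCast, ← Real.rpow_mul hn'.le, ← Real.rpow_one_add' hn'.le]
    · congr 1
      push_cast
      ring
    · push_cast
      linarith
  rw [e] at h
  rw [← ofReal_measureReal]
  exact ENNReal.ofReal_le_ofReal h
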